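/- All graphs are finite, simple and undirected. A clique of a graph is strong if it intersects every maximal independent set; a graph is localizable if its vertex set can be partitioned into strong cliques. A vertex of a graph is strong if every maximal matching of the graph covers it. The diamond is the graph with vertices $a,b,c,d$ and edges $ab,ac,bc,bd,cd$; its tips are $a$ and $d$. Let $H$ be a graph with degree function $d_H$. A pendant triangle of $H$ with root $c$ is a triangle $\{a,b,c\}$ with $d_H(a)=d_H(b)=2<d_H(c)$. A pendant diamond of $H$ with root $d$ is an induced diamond on $a,b,c,d$ with tips $a,d$ such that $d_H(a)=2$ and $d_H(b)=d_H(c)=3\le d_H(d)$. A pendant $K_4$ of $H$ with root $d$ is a $K_4$ on $a,b,c,d$ such that $d_H(a)=d_H(b)=d_H(c)=3<d_H(d)$. Let $R_\triangle(H)$, $R_\Diamond(H)$ and $R_\boxtimes(H)$ be the sets of roots of all pendant triangles, pendant diamonds and pendant $K_4$s of $H$, respectively. The pendant reduction of $H$ is the graph obtained from $H$ by deleting all non-root vertices of its pendant triangles, pendant diamonds and pendant $K_4$s. **Theorem.** Let $H$ be a connected graph. Then the line graph $L(H)$ is localizable if and only if one of the following holds: 1. $H$ is not isomorphic to $K_3$,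 $K_4$ or the diamond, and its pendant reduction $F$ is a connected bipartite graph whose vertex set can be partitioned into two (possibly empty) independent sets $U$ and $W$ such that (a) $R_\Diamond(H)\cup R_\boxtimes(H)\subseteq U$, (b) $R_\triangle(H)\subseteq W$, and (c) each vertex $u\in U\setminus R_\boxtimes(H)$ is strong in the graph $F-(N_F(u)\cap R_\triangle(H))$. 2. $H$ is isomorphic to $K_3$ or $K_4$. -/

import Mathlib

namespace LocalizableGraph

variable {V : Type*}

/-- A clique is strong if it intersects every maximal independent set. -/
def IsStrongClique (G : SimpleGraph V) (C : Set V) : Prop :=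
  G.IsClique C ∧ ∀ I : Set V, Maximal G.IsIndepSet I → (C ∩ I).Nonempty

/-- A graph is localizable if its vertex set has a partition into strong cliques. -/
def IsLocalizable (G : SimpleGraph V) : Prop :=
  ∃ P : Set (Set V), Setoid.IsPartition P ∧ ∀ C ∈ P, IsStrongClique G C

/-- Maximal matchings, ordered by inclusion. The vertex set of a matching consists of
the vertices that it covers. -/
def IsMaximalMatching (G : SimpleGraph V) (M : G.Subgraph) : Prop :=
  Maximal SimpleGraph.Subgraph.IsMatching M

/-- A vertex is strong if every maximal matching covers it. -/
def IsStrongVertex (G : SimpleGraph V) (v : V) : Prop :=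
  ∀ M : G.Subgraph, IsMaximalMatching G M → v ∈ M.verts

/-- The diamond, with vertices `0, 1, 2, 3` and tips `0` and `3`. -/
def diamond : SimpleGraph (Fin 4) :=
  SimpleGraph.fromEdgeSet {s(0, 1), s(0, 2), s(1, 2), s(1, 3), s(2, 3)}

section Pendant

variable [Fintype V] (H : SimpleGraph V) [DecidableRel H.Adj]

/-- `a, b, c` are the vertices of a pendant triangle with root `c`. -/
structure IsPendantTriangle (a b c : V) : Prop where
  ab : H.Adj a b
  ac : H.Adj a c
  bc : H.Adj b c
  deg_a : H.degree a = 2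
  deg_b : H.degree b = 2
  deg_c : 2 < H.degree c

/-- `a, b, c, d` induce a diamond with tips `a`, `d` that is pendant with root `d`. -/
structure IsPendantDiamond (a b c d : V) : Prop where
  ab : H.Adj a b
  ac : H.Adj a c
  bc : H.Adj b c
  bd : H.Adj b d
  cd : H.Adj c d
  ne_ad : a ≠ d
  not_ad : ¬ H.Adj a d
  deg_a : H.degree a = 2
  deg_b : H.degree b = 3
  deg_c : H.degree c = 3
  deg_d : 3 ≤ H.degree d

/-- `a, b, c, d` induce a `K₄` that is pendant with root `d`. -/
structure IsPendantK4 (a b c d : V) : Prop where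
  ab : H.Adj a b
  ac : H.Adj a c
  ad : H.Adj a d
  bc : H.Adj b c
  bd : H.Adj b d
  cd : H.Adj c d
  deg_a : H.degree a = 3
  deg_b : H.degree b = 3
  deg_c : H.degree c = 3
  deg_d : 3 < H.degree d

/-- The roots of the pendant triangles. -/
def triangleRoots : Set V := {r | ∃ a b, IsPendantTriangle H a b r}

/-- The roots of the pendant diamonds. -/
def diamondRoots : Set V := {r | ∃ a b c, IsPendantDiamond H a b c r}

/-- The roots of the pendant `K₄`s. -/
def k4Roots : Set V := {r | ∃ a b c, IsPendantK4 H a b c r}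

/-- The non-root vertices of the pendant subgraphs. -/
def pendantNonRoots : Set V :=
  {v | (∃ a b r, IsPendantTriangle H a b r ∧ (v = a ∨ v = b)) ∨
    (∃ a b c r, IsPendantDiamond H a b c r ∧ (v = a ∨ v = b ∨ v = c)) ∨
    (∃ a b c r, IsPendantK4 H a b c r ∧ (v = a ∨ v = b ∨ v = c))}

end Pendant

/-- The graph `G - X` obtained by deleting a set of vertices. -/
abbrev deleteVerts (G : SimpleGraph V) (X : Set V) : SimpleGraph ↥(Xᶜ) :=
  G.induce Xᶜ

/-- The pendant reduction: delete all non-root vertices of pendant subgraphs. -/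
abbrev pendantReduction [Fintype V] (H : SimpleGraph V) [DecidableRel H.Adj] :
    SimpleGraph ↥((pendantNonRoots H)ᶜ) :=
  deleteVerts H (pendantNonRoots H)

theorem mem_compl_neighborSet_inter (G : SimpleGraph V) (u : V) (R : Set V) :
    u ∈ (G.neighborSet u ∩ R)ᶜ := by
  intro h
  exact G.irrefl h.1

end LocalizableGraph

/-! Independent sets of `L(H)` are matchings of `H`, and a clique of `L(H)` lies in a star or is a
triangle. A strong clique is therefore either the full star of a strong vertex or the edge set of a
triangle such that any two edges leaving it at different vertices end in the same outer vertex
(`IsStrongClique.eq_star_or_eq_triangle`). Hence `L(H)` is localizable exactly when the edges of `H`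
split into stars at an independent set `S` of strong vertices and edge-disjoint strong triangles
avoiding `S`.

If `H` is connected and not `K₃`, `K₄` or the diamond, a strong triangle is the core of a pendant
subgraph: with at most one, exactly two or three of its vertices having outer neighbours, it yields
a pendant triangle, diamond or `K₄` (`IsStrongTriangle.isPendantCore`). No such core contains an
edge of the pendant reduction `F`, so `S` meets every edge of `F` and determines a bipartition of
`F`. Non-root vertices are not strong; this forces diamond and `K₄` roots into `S` and triangle
roots out of it. Conversely, the stars at `U` together with all pendant cores partition the edges.

It remains to compare strength in `H` with condition (c). A neighbour of `u` that is a triangle root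
can be matched into its pendant triangle, and the two neighbours of `u` in a pendant diamond rooted
at `u` can be matched to each other. None of them helps to make `u` strong, so they may be deleted.
A `K₄` root is always strong, since its three pendant neighbours cannot be perfectly matched among
themselves. -/

namespace LocalizableGraph

/-! ### Strong vertices in terms of arbitrary matchings -/

variable {V : Type*}

/-- A graph of maximum degree at most one, that is, the graph of a matching. -/
def IsPairing (N : SimpleGraph V) : Prop :=
  ∀ ⦃a b c : V⦄, N.Adj a b → N.Adj a c → b = c

/-- No matching that misses `v` covers all neighbours of `v`. -/
def IsUnavoidable (G : SimpleGraph V) (v : V) : Prop :=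
  ∀ N ≤ G, IsPairing N → (∀ x, ¬ N.Adj v x) → ∃ w, G.Adj v w ∧ ∀ x, ¬ N.Adj w x

/-- If a maximal extension of a matching missing `v` covers `v` by an edge `vw`, then `w` was free
before, its only possible partner being `v`. Conversely, a maximal matching missing `v` with a free
neighbour `w` could be enlarged by `vw`. -/
theorem isStrongVertex_iff [Finite V] (G : SimpleGraph V) (v : V) :
    IsStrongVertex G v ↔ IsUnavoidable G v := by
  constructor
  · intro h N hN hp hv
    let M₀ : G.Subgraph :=
      { verts := N.support
        Adj := N.Adj
        adj_sub := fun h => hN h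
        edge_vert := fun h => ⟨_, h⟩
        symm := N.symm }
    have hM₀ : M₀.IsMatching := by
      rintro x ⟨w, hw⟩
      exact ⟨w, hw, fun y hy => hp hy hw⟩
    obtain ⟨M, hle, hM⟩ := Finite.exists_le_maximal hM₀
    obtain ⟨w, hw, -⟩ := hM.prop (h M hM)
    refine ⟨w, hw.adj_sub, fun x hx => ?_⟩
    have hx' : M.Adj w x := hle.2 hx
    have : x = v := hM.prop.eq_of_adj_left hx' hw.symm
    subst this
    exact hv _ hx.symm
  · intro h M hM
    by_contra hv
    obtain ⟨w, hw, hw'⟩ := h M.spanningCoe M.spanningCoe_le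
      (fun a b c hb hc => hM.prop.eq_of_adj_left hb hc) (fun x hx => hv (M.edge_vert hx))
    have hwM : w ∉ M.verts := fun hmem => by
      obtain ⟨x, hx, -⟩ := hM.prop hmem
      exact hw' x hx
    have hsup : (M ⊔ G.subgraphOfAdj hw).IsMatching := by
      refine hM.prop.sup (SimpleGraph.Subgraph.IsMatching.subgraphOfAdj hw) ?_
      rw [hM.prop.support_eq_verts, SimpleGraph.support_subgraphOfAdj]
      rw [Set.disjoint_left]
      rintro x hx (rfl | rfl)
      · exact hv hx
      · exact hwM hx
    have hle := hM.le_of_ge hsup le_sup_left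
    exact hv (hle.1 (Or.inr (by simp)))

/-! ### Strong cliques of line graphs: stars and strong triangles -/

theorem lineGraph_adj_iff (H : SimpleGraph V) (e f : H.edgeSet) :
    H.lineGraph.Adj e f ↔ e ≠ f ∧ ∃ v, v ∈ (e : Sym2 V) ∧ v ∈ (f : Sym2 V) := by
  rfl

/-- Strong cliques of a line graph in terms of matchings of the root graph. -/
theorem isStrongClique_lineGraph_iff [Finite V] (H : SimpleGraph V) (C : Set H.edgeSet) :
    IsStrongClique H.lineGraph C ↔ H.lineGraph.IsClique C ∧
      ∀ N ≤ H, IsPairing N → (∀ e ∈ C, (e : Sym2 V) ∉ N.edgeSet) →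
        ∃ a b, ∃ h : H.Adj a b, (⟨s(a, b), h⟩ : H.edgeSet) ∈ C ∧
          (∀ x, ¬ N.Adj a x) ∧ ∀ x, ¬ N.Adj b x := by
  refine and_congr_right fun _ => ⟨fun h N hN hp hC => ?_, fun h I hI => ?_⟩
  · have hI₀ : H.lineGraph.IsIndepSet {e : H.edgeSet | (e : Sym2 V) ∈ N.edgeSet} := by
      rintro ⟨e, he⟩ heN ⟨f, hf⟩ hfN hne hadj
      obtain ⟨-, v, hve, hvf⟩ := (lineGraph_adj_iff H _ _).1 hadj
      obtain ⟨x, rfl⟩ := Sym2.mem_iff_exists.1 hve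
      obtain ⟨y, rfl⟩ := Sym2.mem_iff_exists.1 hvf
      obtain rfl : x = y := hp heN hfN
      exact hne rfl
    obtain ⟨I, hle, hI⟩ := Finite.exists_le_maximal hI₀
    obtain ⟨⟨e, he⟩, heC, heI⟩ := h I hI
    -- An edge of `N` meeting `e` also lies in the independent set `I`, so it equals `e`; but `C`
    -- contains no edge of `N`.
    have key : ∀ a ∈ e, ∀ x, ¬ N.Adj a x := by
      intro a ha x hx
      have hmem : (⟨s(a, x), hN hx⟩ : H.edgeSet) ∈ I := hle hx
      by_cases heq : e = s(a, x)
      · subst heq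
        exact hC _ heC hx
      · exact hI.prop heI hmem (fun h => heq (congrArg Subtype.val h))
          ⟨fun h => heq (congrArg Subtype.val h), a, ha, Sym2.mem_mk_left a x⟩
    induction e with
    | _ a b => exact ⟨a, b, he, heC, key a (by simp), key b (by simp)⟩
  -- If `I` misses `C`, the matching with edge set `I` leaves both ends of some edge of `C` free.
  -- Adding that edge to `I` contradicts maximality.
  · by_contra hemp
    have hadj : ∀ a b, (SimpleGraph.fromEdgeSet (Subtype.val '' I)).Adj a b ↔
        ∃ h : H.Adj a b, (⟨s(a, b), h⟩ : H.edgeSet) ∈ I := by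
      intro a b
      rw [SimpleGraph.fromEdgeSet_adj]
      constructor
      · rintro ⟨⟨⟨e, he⟩, heI, rfl⟩, -⟩
        exact ⟨he, heI⟩
      · rintro ⟨h, hI⟩
        exact ⟨⟨_, hI, rfl⟩, h.ne⟩
    obtain ⟨a, b, hab, habC, ha, hb⟩ := h (SimpleGraph.fromEdgeSet (Subtype.val '' I))
      (fun a b hab => ((hadj a b).1 hab).1) (by
        intro a b c hb hc
        obtain ⟨hb, hbI⟩ := (hadj _ _).1 hb
        obtain ⟨hc, hcI⟩ := (hadj _ _).1 hc
        by_contra hne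
        have hne' : (⟨s(a, b), hb⟩ : H.edgeSet) ≠ ⟨s(a, c), hc⟩ := by
          intro h
          exact hne (Sym2.congr_right.1 (congrArg Subtype.val h))
        exact hI.prop hbI hcI hne'
          ⟨hne', a, Sym2.mem_mk_left a b, Sym2.mem_mk_left a c⟩) (by
        rintro ⟨e, he⟩ heC heN
        induction e with
        | _ a b =>
          obtain ⟨h, hI'⟩ := (hadj a b).1 heN
          exact hemp ⟨_, heC, hI'⟩)
    have hI' : H.lineGraph.IsIndepSet (insert ⟨s(a, b), hab⟩ I) := by
      have aux : ∀ f ∈ I, ¬ H.lineGraph.Adj ⟨s(a, b), hab⟩ f := by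
        rintro ⟨f, hf⟩ hfI ⟨-, v, hv, hvf⟩
        obtain ⟨x, rfl⟩ := Sym2.mem_iff_exists.1 hvf
        rcases Sym2.mem_iff.1 hv with rfl | rfl
        · exact ha x ((hadj _ _).2 ⟨hf, hfI⟩)
        · exact hb x ((hadj _ _).2 ⟨hf, hfI⟩)
      rintro e (rfl | he) f (rfl | hf) hne hadj'
      · exact hne rfl
      · exact aux f hf hadj'
      · exact aux e he hadj'.symm
      · exact hI.prop he hf hne hadj'
    exact hemp ⟨_, habC, hI.le_of_ge hI' (Set.subset_insert _ _) (Set.mem_insert _ _)⟩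

/-- The edges at a vertex. -/
def star (H : SimpleGraph V) (v : V) : Set H.edgeSet := {e | v ∈ (e : Sym2 V)}

/-- The edges with both ends in a given set. -/
def edgesIn (H : SimpleGraph V) (s : Set V) : Set H.edgeSet := {e | ∀ v ∈ (e : Sym2 V), v ∈ s}

@[simp] theorem mk_mem_star {H : SimpleGraph V} {v a b : V} (h : s(a, b) ∈ H.edgeSet) :
    (⟨s(a, b), h⟩ : H.edgeSet) ∈ star H v ↔ v = a ∨ v = b := by
  simp [star]

@[simp] theorem mk_mem_edgesIn {H : SimpleGraph V} {s : Set V} {a b : V}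
    (h : s(a, b) ∈ H.edgeSet) :
    (⟨s(a, b), h⟩ : H.edgeSet) ∈ edgesIn H s ↔ a ∈ s ∧ b ∈ s := by
  simp [edgesIn]

/-- A triangle whose edges meet every maximal matching. -/
structure IsStrongTriangle (H : SimpleGraph V) (a b c : V) : Prop where
  ab : H.Adj a b
  ac : H.Adj a c
  bc : H.Adj b c
  out_ab : ∀ x y, x ≠ b → x ≠ c → y ≠ a → y ≠ c → H.Adj a x → H.Adj b y → x = y
  out_ac : ∀ x y, x ≠ b → x ≠ c → y ≠ a → y ≠ b → H.Adj a x → H.Adj c y → x = y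
  out_bc : ∀ x y, x ≠ a → x ≠ c → y ≠ a → y ≠ b → H.Adj b x → H.Adj c y → x = y

theorem IsStrongTriangle.swap {H : SimpleGraph V} {a b c : V} (h : IsStrongTriangle H a b c) :
    IsStrongTriangle H b a c :=
  ⟨h.ab.symm, h.bc, h.ac, fun x y h₁ h₂ h₃ h₄ h₅ h₆ => (h.out_ab y x h₃ h₄ h₁ h₂ h₆ h₅).symm,
    fun x y h₁ h₂ h₃ h₄ h₅ h₆ => h.out_bc x y h₁ h₂ h₄ h₃ h₅ h₆,
    fun x y h₁ h₂ h₃ h₄ h₅ h₆ => h.out_ac x y h₁ h₂ h₄ h₃ h₅ h₆⟩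

theorem IsStrongTriangle.rotate {H : SimpleGraph V} {a b c : V} (h : IsStrongTriangle H a b c) :
    IsStrongTriangle H b c a :=
  ⟨h.bc, h.ab.symm, h.ac.symm, fun x y h₁ h₂ h₃ h₄ h₅ h₆ => h.out_bc x y h₂ h₁ h₄ h₃ h₅ h₆,
    fun x y h₁ h₂ h₃ h₄ h₅ h₆ => (h.out_ab y x h₃ h₄ h₂ h₁ h₆ h₅).symm,
    fun x y h₁ h₂ h₃ h₄ h₅ h₆ => (h.out_ac y x h₃ h₄ h₂ h₁ h₆ h₅).symm⟩

theorem isClique_star (H : SimpleGraph V) (v : V) : H.lineGraph.IsClique (star H v) :=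
  fun _ he _ hf hne => ⟨hne, v, he, hf⟩

theorem isStrongClique_star_iff [Finite V] (H : SimpleGraph V) (v : V) :
    IsStrongClique H.lineGraph (star H v) ↔ IsUnavoidable H v := by
  rw [isStrongClique_lineGraph_iff]
  refine (and_iff_right (isClique_star H v)).trans ?_
  constructor
  · intro h N hN hp hv
    obtain ⟨a, b, hab, hmem, ha, hb⟩ := h N hN hp (by
      rintro ⟨e, he⟩ hve heN
      obtain ⟨x, rfl⟩ := Sym2.mem_iff_exists.1 (show v ∈ e from hve)
      exact hv x heN)
    rcases (mk_mem_star hab).1 hmem with rfl | rfl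
    · exact ⟨b, hab, hb⟩
    · exact ⟨a, hab.symm, ha⟩
  · intro h N hN hp hC
    have hv : ∀ x, ¬ N.Adj v x := fun x hx =>
      hC ⟨s(v, x), hN hx⟩ ((mk_mem_star _).2 (by simp)) hx
    obtain ⟨w, hw, hw'⟩ := h N hN hp hv
    exact ⟨v, w, hw, (mk_mem_star _).2 (by simp), hv, hw'⟩

theorem isPairing_edge {x y : V} : IsPairing (SimpleGraph.fromEdgeSet {s(x, y)}) := by
  intro a b c hb hc
  simp only [SimpleGraph.fromEdgeSet_adj, Set.mem_singleton_iff, Sym2.eq_iff] at hb hc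
  grind

theorem isPairing_two_edges {x y z w : V} (hxz : x ≠ z) (hxw : x ≠ w) (hyz : y ≠ z)
    (hyw : y ≠ w) : IsPairing (SimpleGraph.fromEdgeSet {s(x, y), s(z, w)}) := by
  intro a b c hb hc
  simp only [SimpleGraph.fromEdgeSet_adj, Set.mem_insert_iff, Set.mem_singleton_iff,
    Sym2.eq_iff] at hb hc
  grind

/-- A strong clique inside a star is the whole star. -/
theorem eq_star_of_subset [Finite V] {H : SimpleGraph V} {C : Set H.edgeSet} {v : V}
    (hC : IsStrongClique H.lineGraph C) (hv : C ⊆ star H v) : C = star H v := by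
  refine hv.antisymm ?_
  rintro ⟨e, he⟩ hve
  obtain ⟨x, rfl⟩ := Sym2.mem_iff_exists.1 (show v ∈ e from hve)
  by_contra hnot
  -- The matching `{vx}` avoids `C` but covers `v`, an end of every edge of `C`.
  obtain ⟨a, b, hab, hmem, ha, hb⟩ := ((isStrongClique_lineGraph_iff H C).1 hC).2
    (SimpleGraph.fromEdgeSet {s(v, x)}) (by
      rw [SimpleGraph.fromEdgeSet_le]
      rintro f ⟨rfl, -⟩
      exact he) isPairing_edge (by
      rintro ⟨f, hf⟩ hfC hfN
      simp only [SimpleGraph.edgeSet_fromEdgeSet, Set.mem_sdiff, Set.mem_singleton_iff] at hfN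
      obtain ⟨rfl, -⟩ := hfN
      exact hnot hfC)
  have hvx : (SimpleGraph.fromEdgeSet {s(v, x)}).Adj v x := by
    simpa using (show H.Adj v x from he).ne
  rcases (mk_mem_star hab).1 (hv hmem) with rfl | rfl
  · exact ha x hvx
  · exact hb x hvx

/-- Cliques of a line graph are contained in stars or are triangles. -/
theorem subset_star_or_eq_triangle {H : SimpleGraph V} {C : Set H.edgeSet}
    (hC : H.lineGraph.IsClique C) (hne : C.Nonempty) :
    (∃ v, C ⊆ star H v) ∨
      ∃ a b c, H.Adj a b ∧ H.Adj a c ∧ H.Adj b c ∧ C = edgesIn H {a, b, c} := by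
  have meet : ∀ e ∈ C, ∀ f ∈ C, ∃ v, v ∈ (e : Sym2 V) ∧ v ∈ (f : Sym2 V) := by
    intro e he f hf
    by_cases hef : e = f
    · subst hef
      obtain ⟨e, he'⟩ := e
      induction e with
      | _ a b => exact ⟨a, by simp⟩
    · exact ((lineGraph_adj_iff H _ _).1 (hC he hf hef)).2
  obtain ⟨⟨e, he⟩, heC⟩ := hne
  induction e with
  | _ a b =>
    by_cases h₁ : C ⊆ star H a
    · exact Or.inl ⟨a, h₁⟩
    by_cases h₂ : C ⊆ star H b
    · exact Or.inl ⟨b, h₂⟩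
    right
    -- Both `f` and `g` meet `ab`; `f` misses `a` and `g` misses `b`. So `f = bc` and `g = ad`, and
    -- `c = d` because they meet. Any edge meeting all three sides of a triangle is one of its
    -- sides.
    obtain ⟨⟨f, hf⟩, hfC, haf⟩ := Set.not_subset.1 h₁
    obtain ⟨⟨g, hg⟩, hgC, hbg⟩ := Set.not_subset.1 h₂
    have hbf : b ∈ f := by
      obtain ⟨v, hv, hvf⟩ := meet _ heC _ hfC
      rcases Sym2.mem_iff.1 hv with rfl | rfl
      · exact absurd hvf haf
      · exact hvf
    have hag : a ∈ g := by
      obtain ⟨v, hv, hvg⟩ := meet _ heC _ hgC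
      rcases Sym2.mem_iff.1 hv with rfl | rfl
      · exact hvg
      · exact absurd hvg hbg
    obtain ⟨c, rfl⟩ := Sym2.mem_iff_exists.1 hbf
    obtain ⟨d, rfl⟩ := Sym2.mem_iff_exists.1 hag
    rw [mk_mem_star, not_or] at haf hbg
    obtain rfl : c = d := by
      obtain ⟨v, hv, hv'⟩ := meet _ hfC _ hgC
      simp only [Sym2.mem_iff] at hv hv'
      grind
    refine ⟨a, b, c, he, hg, hf, ?_⟩
    ext ⟨h, hh⟩
    induction h with
    | _ x y =>
      have hxy : x ≠ y := (show H.Adj x y from hh).ne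
      rw [mk_mem_edgesIn]
      constructor
      · intro hmem
        obtain ⟨p, hp, hp'⟩ := meet _ hmem _ heC
        obtain ⟨q, hq, hq'⟩ := meet _ hmem _ hfC
        obtain ⟨r, hr, hr'⟩ := meet _ hmem _ hgC
        simp only [Sym2.mem_iff] at hp hp' hq hq' hr hr'
        simp only [Set.mem_insert_iff, Set.mem_singleton_iff]
        grind
      · simp only [Set.mem_insert_iff, Set.mem_singleton_iff]
        rintro ⟨rfl | rfl | rfl, rfl | rfl | rfl⟩ <;> first
          | exact absurd rfl hxy
          | assumption
          | (simp only [Sym2.eq_swap (a := x)]; assumption)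

/-- Two disjoint edges leaving the triangle at different vertices would form a matching that
contains no side but covers an end of every side. -/
theorem IsStrongTriangle.of_isStrongClique [Finite V] {H : SimpleGraph V} {a b c : V}
    (hab : H.Adj a b) (hac : H.Adj a c) (hbc : H.Adj b c)
    (h : IsStrongClique H.lineGraph (edgesIn H {a, b, c})) : IsStrongTriangle H a b c := by
  have key : ∀ p q x y, p ≠ q → x ∉ ({a, b, c} : Set V) → y ∉ ({a, b, c} : Set V) →
      p ∈ ({a, b, c} : Set V) → q ∈ ({a, b, c} : Set V) →
      H.Adj p x → H.Adj q y → x = y := by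
    intro p q x y hpq hx hy hp hq hpx hqy
    by_contra hxy
    have hpy : p ≠ y := fun h => hy (h ▸ hp)
    have hxq : x ≠ q := fun h => hx (h ▸ hq)
    obtain ⟨u, v, huv, hmem, hu, hv⟩ := ((isStrongClique_lineGraph_iff H _).1 h).2
      (SimpleGraph.fromEdgeSet {s(p, x), s(q, y)}) (by
        rw [SimpleGraph.fromEdgeSet_le]
        rintro f ⟨rfl | rfl, -⟩
        · exact hpx
        · exact hqy) (isPairing_two_edges hpq hpy hxq hxy) (by
        rintro ⟨f, hf⟩ hfC hfN
        simp only [SimpleGraph.edgeSet_fromEdgeSet, Set.mem_sdiff, Set.mem_insert_iff,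
          Set.mem_singleton_iff] at hfN
        obtain ⟨rfl | rfl, -⟩ := hfN
        · exact hx ((mk_mem_edgesIn hf).1 hfC).2
        · exact hy ((mk_mem_edgesIn hf).1 hfC).2)
    have hp' : (SimpleGraph.fromEdgeSet {s(p, x), s(q, y)}).Adj p x := by
      simpa using hpx.ne
    have hq' : (SimpleGraph.fromEdgeSet {s(p, x), s(q, y)}).Adj q y := by
      simpa using hqy.ne
    have hup : u ≠ p := by rintro rfl; exact hu _ hp'
    have huq : u ≠ q := by rintro rfl; exact hu _ hq'
    have hvp : v ≠ p := by rintro rfl; exact hv _ hp'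
    have hvq : v ≠ q := by rintro rfl; exact hv _ hq'
    have := huv.ne
    have hmem := (mk_mem_edgesIn huv).1 hmem
    simp only [Set.mem_insert_iff, Set.mem_singleton_iff] at hmem hp hq
    grind
  have := hab.ne
  have := hac.ne
  have := hbc.ne
  refine ⟨hab, hac, hbc, ?_, ?_, ?_⟩ <;> intro x y h₁ h₂ h₃ h₄ h₅ h₆
  · have := h₅.ne
    have := h₆.ne
    exact key a b x y hab.ne (by grind) (by grind) (by simp) (by simp) h₅ h₆
  · have := h₅.ne
    have := h₆.ne
    exact key a c x y hac.ne (by grind) (by grind) (by simp) (by simp) h₅ h₆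
  · have := h₅.ne
    have := h₆.ne
    exact key b c x y hbc.ne (by grind) (by grind) (by simp) (by simp) h₅ h₆

/-- In a matching containing no side, covered triangle vertices have outer partners. Two of them
would share a partner, so at most one is covered and the opposite side is free. -/
theorem IsStrongTriangle.isStrongClique [Finite V] {H : SimpleGraph V} {a b c : V}
    (h : IsStrongTriangle H a b c) : IsStrongClique H.lineGraph (edgesIn H {a, b, c}) := by
  rw [isStrongClique_lineGraph_iff]
  have h₁ := h.ab.ne
  have h₂ := h.ac.ne
  have h₃ := h.bc.ne
  constructor
  · rintro ⟨e, he⟩ heC ⟨f, hf⟩ hfC hne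
    refine ⟨hne, ?_⟩
    induction e with
    | _ x y =>
    induction f with
    | _ z w =>
      have := (show H.Adj x y from he).ne
      have := (show H.Adj z w from hf).ne
      rw [mk_mem_edgesIn] at heC hfC
      simp only [Set.mem_insert_iff, Set.mem_singleton_iff] at heC hfC
      have : x = z ∨ x = w ∨ y = z ∨ y = w := by grind
      rcases this with rfl | rfl | rfl | rfl
      · exact ⟨x, by simp, by simp⟩
      · exact ⟨x, by simp, by simp⟩
      · exact ⟨y, by simp, by simp⟩
      · exact ⟨y, by simp, by simp⟩
  · intro N hN hp hC
    have inside : ∀ x y, N.Adj x y → x ∈ ({a, b, c} : Set V) → y ∉ ({a, b, c} : Set V) :=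
      fun x y hxy hx hy => hC ⟨s(x, y), hN hxy⟩ ((mk_mem_edgesIn _).2 ⟨hx, hy⟩) hxy
    have hab : (∃ x, N.Adj a x) → ∀ y, ¬ N.Adj b y := by
      rintro ⟨x, hx⟩ y hy
      have i₁ := inside _ _ hx (by simp)
      have i₂ := inside _ _ hy (by simp)
      simp only [Set.mem_insert_iff, Set.mem_singleton_iff, not_or] at i₁ i₂
      obtain rfl := h.out_ab x y i₁.2.1 i₁.2.2 i₂.1 i₂.2.2 (hN hx) (hN hy)
      exact h₁ (hp hx.symm hy.symm)
    have hac : (∃ x, N.Adj a x) → ∀ y, ¬ N.Adj c y := by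
      rintro ⟨x, hx⟩ y hy
      have i₁ := inside _ _ hx (by simp)
      have i₂ := inside _ _ hy (by simp)
      simp only [Set.mem_insert_iff, Set.mem_singleton_iff, not_or] at i₁ i₂
      obtain rfl := h.out_ac x y i₁.2.1 i₁.2.2 i₂.1 i₂.2.1 (hN hx) (hN hy)
      exact h₂ (hp hx.symm hy.symm)
    have hbc : (∃ x, N.Adj b x) → ∀ y, ¬ N.Adj c y := by
      rintro ⟨x, hx⟩ y hy
      have i₁ := inside _ _ hx (by simp)
      have i₂ := inside _ _ hy (by simp)
      simp only [Set.mem_insert_iff, Set.mem_singleton_iff, not_or] at i₁ i₂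
      obtain rfl := h.out_bc x y i₁.1 i₁.2.2 i₂.1 i₂.2.1 (hN hx) (hN hy)
      exact h₃ (hp hx.symm hy.symm)
    by_cases ha : ∃ x, N.Adj a x
    · exact ⟨b, c, h.bc, (mk_mem_edgesIn _).2 (by simp), hab ha, hac ha⟩
    by_cases hb : ∃ x, N.Adj b x
    · exact ⟨a, c, h.ac, (mk_mem_edgesIn _).2 (by simp), not_exists.1 ha, hbc hb⟩
    · exact ⟨a, b, h.ab, (mk_mem_edgesIn _).2 (by simp), not_exists.1 ha, not_exists.1 hb⟩

theorem IsStrongClique.nonempty [Finite V] {H : SimpleGraph V} {C : Set H.edgeSet}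
    (h : IsStrongClique H.lineGraph C) : C.Nonempty := by
  obtain ⟨a, b, hab, hmem, -⟩ := ((isStrongClique_lineGraph_iff H C).1 h).2 ⊥ bot_le
    (by intro a b c h; exact absurd h (by simp)) (by simp)
  exact ⟨_, hmem⟩

theorem IsStrongClique.eq_star_or_eq_triangle [Finite V] {H : SimpleGraph V}
    {C : Set H.edgeSet} (h : IsStrongClique H.lineGraph C) :
    (∃ v, C = star H v ∧ IsUnavoidable H v) ∨
      ∃ a b c, C = edgesIn H {a, b, c} ∧ IsStrongTriangle H a b c := by
  rcases subset_star_or_eq_triangle h.1 h.nonempty with ⟨v, hv⟩ | ⟨a, b, c, hab, hac, hbc, rfl⟩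
  · obtain rfl := eq_star_of_subset h hv
    exact Or.inl ⟨v, rfl, (isStrongClique_star_iff H v).1 h⟩
  · exact Or.inr ⟨a, b, c, rfl, .of_isStrongClique hab hac hbc h⟩

/-- A sufficient criterion: a cover of the edges by disjoint stars and strong triangles. -/
theorem isLocalizable_of_cover [Finite V] (H : SimpleGraph V) (S : Set V) (T : Set (Set V))
    (hS : ∀ v ∈ S, IsUnavoidable H v) (hSS : ∀ u ∈ S, ∀ v ∈ S, ¬ H.Adj u v)
    (hT : ∀ s ∈ T, ∃ a b c, s = {a, b, c} ∧ IsStrongTriangle H a b c)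
    (hST : ∀ v ∈ S, ∀ s ∈ T, v ∉ s)
    (hTT : ∀ s ∈ T, ∀ t ∈ T, ∀ x y, x ≠ y → x ∈ s → y ∈ s → x ∈ t → y ∈ t → s = t)
    (hcover : ∀ x y, H.Adj x y → x ∈ S ∨ y ∈ S ∨ ∃ s ∈ T, x ∈ s ∧ y ∈ s) :
    IsLocalizable H.lineGraph := by
  have hstrong : ∀ C ∈ star H '' S ∪ edgesIn H '' T, IsStrongClique H.lineGraph C := by
    rintro _ (⟨v, hv, rfl⟩ | ⟨s, hs, rfl⟩)
    · exact (isStrongClique_star_iff H v).2 (hS v hv)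
    · obtain ⟨a, b, c, rfl, h⟩ := hT s hs
      exact h.isStrongClique
  refine ⟨star H '' S ∪ edgesIn H '' T, ⟨fun h => ?_, ?_⟩, hstrong⟩
  · exact Set.not_nonempty_empty (hstrong _ h).nonempty
  · rintro ⟨e, he⟩
    induction e with
    | _ x y =>
    have hxy : x ≠ y := (show H.Adj x y from he).ne
    refine existsUnique_of_exists_of_unique ?_ ?_
    · rcases hcover x y he with h | h | ⟨s, hs, hx, hy⟩
      · exact ⟨_, Or.inl ⟨x, h, rfl⟩, by simp⟩
      · exact ⟨_, Or.inl ⟨y, h, rfl⟩, by simp⟩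
      · exact ⟨_, Or.inr ⟨s, hs, rfl⟩, by simp [hx, hy]⟩
    · rintro _ _ ⟨⟨u, hu, rfl⟩ | ⟨s, hs, rfl⟩, h₁⟩ ⟨⟨v, hv, rfl⟩ | ⟨t, ht, rfl⟩, h₂⟩
      · rw [mk_mem_star] at h₁ h₂
        rcases h₁ with rfl | rfl <;> rcases h₂ with rfl | rfl
        · rfl
        · exact absurd he (hSS _ hu _ hv)
        · exact absurd he (hSS _ hv _ hu)
        · rfl
      · rw [mk_mem_star] at h₁
        rw [mk_mem_edgesIn] at h₂
        rcases h₁ with rfl | rfl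
        · exact absurd h₂.1 (hST _ hu _ ht)
        · exact absurd h₂.2 (hST _ hu _ ht)
      · rw [mk_mem_star] at h₂
        rw [mk_mem_edgesIn] at h₁
        rcases h₂ with rfl | rfl
        · exact absurd h₁.1 (hST _ hv _ hs)
        · exact absurd h₁.2 (hST _ hv _ hs)
      · rw [mk_mem_edgesIn] at h₁ h₂
        rw [hTT s hs t ht x y hxy h₁.1 h₁.2 h₂.1 h₂.2]

end LocalizableGraph

/-! ### Degrees, pendant subgraphs and their cores -/

namespace LocalizableGraph

variable {V : Type*}

theorem not_isUnavoidable_of_edge {H : SimpleGraph V} {v b c : V} (hbc : H.Adj b c)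
    (hb : v ≠ b) (hc : v ≠ c) (hv : ∀ x, H.Adj v x → x = b ∨ x = c) : ¬ IsUnavoidable H v := by
  intro h
  have hadj : (SimpleGraph.fromEdgeSet {s(b, c)}).Adj b c := by simpa using hbc.ne
  obtain ⟨w, hw, hw'⟩ := h (SimpleGraph.fromEdgeSet {s(b, c)}) (by
    rw [SimpleGraph.fromEdgeSet_le]
    rintro f ⟨rfl, -⟩
    exact hbc) isPairing_edge (by
    intro x hx
    simp only [SimpleGraph.fromEdgeSet_adj, Set.mem_singleton_iff, Sym2.eq_iff] at hx
    grind)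
  rcases hv w hw with rfl | rfl
  · exact hw' _ hadj
  · exact hw' _ hadj.symm

theorem not_isUnavoidable_of_two_edges {H : SimpleGraph V} {v x y z w : V} (hxy : H.Adj x y)
    (hzw : H.Adj z w) (hxz : x ≠ z) (hxw : x ≠ w) (hyz : y ≠ z) (hyw : y ≠ w)
    (hvx : v ≠ x) (hvy : v ≠ y) (hvz : v ≠ z) (hvw : v ≠ w)
    (hv : ∀ u, H.Adj v u → u = x ∨ u = y ∨ u = z ∨ u = w) : ¬ IsUnavoidable H v := by
  intro h
  have hadj : (SimpleGraph.fromEdgeSet {s(x, y), s(z, w)}).Adj x y := by simpa using hxy.ne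
  have hadj' : (SimpleGraph.fromEdgeSet {s(x, y), s(z, w)}).Adj z w := by simpa using hzw.ne
  obtain ⟨u, hu, hu'⟩ := h (SimpleGraph.fromEdgeSet {s(x, y), s(z, w)}) (by
    rw [SimpleGraph.fromEdgeSet_le]
    rintro f ⟨rfl | rfl, -⟩
    · exact hxy
    · exact hzw) (isPairing_two_edges hxz hxw hyz hyw) (by
    intro u hu
    simp only [SimpleGraph.fromEdgeSet_adj, Set.mem_insert_iff, Set.mem_singleton_iff,
      Sym2.eq_iff] at hu
    grind)
  rcases hv u hu with rfl | rfl | rfl | rfl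
  · exact hu' _ hadj
  · exact hu' _ hadj.symm
  · exact hu' _ hadj'
  · exact hu' _ hadj'.symm

section Degree

variable [Fintype V] (H : SimpleGraph V) [DecidableRel H.Adj]

theorem degree_eq_card_iff (v : V) (s : Finset V) (hs : ∀ x ∈ s, H.Adj v x) :
    H.degree v = s.card ↔ ∀ x, H.Adj v x → x ∈ s := by
  have hsub : s ⊆ H.neighborFinset v := fun x hx => by simpa using hs x hx
  rw [← SimpleGraph.card_neighborFinset_eq_degree]
  constructor
  · intro h x hx
    rw [Finset.eq_of_subset_of_card_le hsub h.le]
    simpa using hx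
  · intro h
    congr 1
    exact Finset.Subset.antisymm (fun x hx => h x (by simpa using hx)) hsub

theorem card_lt_degree_iff (v : V) (s : Finset V) (hs : ∀ x ∈ s, H.Adj v x) :
    s.card < H.degree v ↔ ∃ x, H.Adj v x ∧ x ∉ s := by
  have hsub : s ⊆ H.neighborFinset v := fun x hx => by simpa using hs x hx
  have hle : s.card ≤ H.degree v := by
    rw [← SimpleGraph.card_neighborFinset_eq_degree]
    exact Finset.card_le_card hsub
  rw [lt_iff_le_and_ne, and_iff_right hle, ne_comm, Ne, degree_eq_card_iff H v s hs]
  push Not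
  rfl

variable {H} {v b c d : V}

theorem degree_eq_two_iff (hb : H.Adj v b) (hc : H.Adj v c) (hbc : b ≠ c) :
    H.degree v = 2 ↔ ∀ x, H.Adj v x → x = b ∨ x = c := by
  classical
  simpa [Finset.card_pair hbc] using degree_eq_card_iff H v {b, c} (by simp [hb, hc])

theorem two_lt_degree_iff (hb : H.Adj v b) (hc : H.Adj v c) (hbc : b ≠ c) :
    2 < H.degree v ↔ ∃ x, H.Adj v x ∧ x ≠ b ∧ x ≠ c := by
  classical
  simpa [Finset.card_pair hbc] using card_lt_degree_iff H v {b, c} (by simp [hb, hc])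

theorem degree_eq_three_iff (hb : H.Adj v b) (hc : H.Adj v c) (hd : H.Adj v d) (hbc : b ≠ c)
    (hbd : b ≠ d) (hcd : c ≠ d) :
    H.degree v = 3 ↔ ∀ x, H.Adj v x → x = b ∨ x = c ∨ x = d := by
  classical
  have hcard : ({b, c, d} : Finset V).card = 3 := Finset.card_eq_three.2 ⟨b, c, d, hbc, hbd, hcd, rfl⟩
  simpa [hcard] using degree_eq_card_iff H v {b, c, d} (by simp [hb, hc, hd])

theorem three_lt_degree_iff (hb : H.Adj v b) (hc : H.Adj v c) (hd : H.Adj v d) (hbc : b ≠ c)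
    (hbd : b ≠ d) (hcd : c ≠ d) :
    3 < H.degree v ↔ ∃ x, H.Adj v x ∧ x ≠ b ∧ x ≠ c ∧ x ≠ d := by
  classical
  have hcard : ({b, c, d} : Finset V).card = 3 := Finset.card_eq_three.2 ⟨b, c, d, hbc, hbd, hcd, rfl⟩
  simpa [hcard] using card_lt_degree_iff H v {b, c, d} (by simp [hb, hc, hd])

end Degree

section Pendant

variable [Fintype V] {H : SimpleGraph V} [DecidableRel H.Adj] {a b c d x : V}

namespace IsPendantTriangle

theorem swap (h : IsPendantTriangle H a b c) : IsPendantTriangle H b a c :=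
  ⟨h.ab.symm, h.bc, h.ac, h.deg_b, h.deg_a, h.deg_c⟩

theorem adj_a (h : IsPendantTriangle H a b c) (hx : H.Adj a x) : x = b ∨ x = c :=
  (degree_eq_two_iff h.ab h.ac h.bc.ne).1 h.deg_a x hx

theorem adj_b (h : IsPendantTriangle H a b c) (hx : H.Adj b x) : x = a ∨ x = c :=
  h.swap.adj_a hx

theorem isStrongTriangle (h : IsPendantTriangle H a b c) : IsStrongTriangle H a b c := by
  refine ⟨h.ab, h.ac, h.bc, ?_, ?_, ?_⟩ <;> intro x y h₁ h₂ h₃ h₄ h₅ h₆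
  · have := h.adj_a h₅
    grind
  · have := h.adj_a h₅
    grind
  · have := h.adj_b h₅
    grind

theorem not_isUnavoidable (h : IsPendantTriangle H a b c) : ¬ IsUnavoidable H a :=
  not_isUnavoidable_of_edge h.bc h.ab.ne h.ac.ne fun _ => h.adj_a

end IsPendantTriangle

namespace IsPendantDiamond

theorem swap (h : IsPendantDiamond H a b c d) : IsPendantDiamond H a c b d :=
  ⟨h.ac, h.ab, h.bc.symm, h.cd, h.bd, h.ne_ad, h.not_ad, h.deg_a, h.deg_c, h.deg_b, h.deg_d⟩

theorem adj_a (h : IsPendantDiamond H a b c d) (hx : H.Adj a x) : x = b ∨ x = c :=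
  (degree_eq_two_iff h.ab h.ac h.bc.ne).1 h.deg_a x hx

theorem adj_b (h : IsPendantDiamond H a b c d) (hx : H.Adj b x) : x = a ∨ x = c ∨ x = d :=
  (degree_eq_three_iff h.ab.symm h.bc h.bd h.ac.ne h.ne_ad h.cd.ne).1 h.deg_b x hx

theorem adj_c (h : IsPendantDiamond H a b c d) (hx : H.Adj c x) : x = a ∨ x = b ∨ x = d :=
  h.swap.adj_b hx

theorem exists_adj_d (h : IsPendantDiamond H a b c d) : ∃ x, H.Adj d x ∧ x ≠ b ∧ x ≠ c :=
  (two_lt_degree_iff h.bd.symm h.cd.symm h.bc.ne).1 h.deg_d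

theorem isStrongTriangle (h : IsPendantDiamond H a b c d) : IsStrongTriangle H a b c := by
  refine ⟨h.ab, h.ac, h.bc, ?_, ?_, ?_⟩ <;> intro x y h₁ h₂ h₃ h₄ h₅ h₆
  · have := h.adj_a h₅
    grind
  · have := h.adj_a h₅
    grind
  · have := h.adj_b h₅
    have := h.adj_c h₆
    grind

theorem not_isUnavoidable_a (h : IsPendantDiamond H a b c d) : ¬ IsUnavoidable H a :=
  not_isUnavoidable_of_edge h.bc h.ab.ne h.ac.ne fun _ => h.adj_a

/-- The degree of `d` gives a further neighbour `x`, which is not the tip `a`. The matching `{ac,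
dx}` misses `b` and covers all its neighbours. -/
theorem not_isUnavoidable_b (h : IsPendantDiamond H a b c d) : ¬ IsUnavoidable H b := by
  obtain ⟨x, hx, hxb, hxc⟩ := h.exists_adj_d
  have hax : a ≠ x := by rintro rfl; exact h.not_ad hx.symm
  exact not_isUnavoidable_of_two_edges h.ac hx h.ne_ad hax h.cd.ne hxc.symm h.ab.ne' h.bc.ne
    h.bd.ne hxb.symm fun u hu => by have := h.adj_b hu; grind

end IsPendantDiamond

namespace IsPendantK4

theorem swap (h : IsPendantK4 H a b c d) : IsPendantK4 H b a c d :=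
  ⟨h.ab.symm, h.bc, h.bd, h.ac, h.ad, h.cd, h.deg_b, h.deg_a, h.deg_c, h.deg_d⟩

theorem rotate (h : IsPendantK4 H a b c d) : IsPendantK4 H b c a d :=
  ⟨h.bc, h.ab.symm, h.bd, h.ac.symm, h.cd, h.ad, h.deg_b, h.deg_c, h.deg_a, h.deg_d⟩

theorem adj_a (h : IsPendantK4 H a b c d) (hx : H.Adj a x) : x = b ∨ x = c ∨ x = d :=
  (degree_eq_three_iff h.ab h.ac h.ad h.bc.ne h.bd.ne h.cd.ne).1 h.deg_a x hx

theorem exists_adj_d (h : IsPendantK4 H a b c d) : ∃ x, H.Adj d x ∧ x ≠ a ∧ x ≠ b ∧ x ≠ c :=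
  (three_lt_degree_iff h.ad.symm h.bd.symm h.cd.symm h.ab.ne h.ac.ne h.bc.ne).1 h.deg_d

theorem isStrongTriangle (h : IsPendantK4 H a b c d) : IsStrongTriangle H a b c := by
  refine ⟨h.ab, h.ac, h.bc, ?_, ?_, ?_⟩ <;> intro x y h₁ h₂ h₃ h₄ h₅ h₆
  · have := h.adj_a h₅
    have := h.rotate.adj_a h₆
    grind
  · have := h.adj_a h₅
    have := h.rotate.rotate.adj_a h₆
    grind
  · have := h.rotate.adj_a h₅
    have := h.rotate.rotate.adj_a h₆
    grind

theorem not_isUnavoidable (h : IsPendantK4 H a b c d) : ¬ IsUnavoidable H a := by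
  obtain ⟨x, hx, hxa, hxb, hxc⟩ := h.exists_adj_d
  exact not_isUnavoidable_of_two_edges h.bc hx h.bd.ne hxb.symm h.cd.ne hxc.symm h.ab.ne h.ac.ne
    h.ad.ne hxa.symm fun u hu => by have := h.adj_a hu; grind

end IsPendantK4

variable (H) in
/-- `v` is a non-root vertex of a pendant subgraph with root `r`. -/
def IsNonRootOf (v r : V) : Prop :=
  (∃ a b, IsPendantTriangle H a b r ∧ (v = a ∨ v = b)) ∨
    (∃ a b c, IsPendantDiamond H a b c r ∧ (v = a ∨ v = b ∨ v = c)) ∨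
    (∃ a b c, IsPendantK4 H a b c r ∧ (v = a ∨ v = b ∨ v = c))

variable (H) in
/-- `s` is the strong triangle contained in a pendant subgraph. -/
def IsPendantCore (s : Set V) : Prop :=
  ∃ a b c, s = {a, b, c} ∧ (IsPendantTriangle H a b c ∨ (∃ d, IsPendantDiamond H a b c d) ∨
    ∃ d, IsPendantK4 H a b c d)

theorem mem_pendantNonRoots_iff {v : V} : v ∈ pendantNonRoots H ↔ ∃ r, IsNonRootOf H v r := by
  simp only [pendantNonRoots, IsNonRootOf, Set.mem_ofPred_eq]
  constructor
  · rintro (⟨a, b, r, h⟩ | ⟨a, b, c, r, h⟩ | ⟨a, b, c, r, h⟩)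
    · exact ⟨r, Or.inl ⟨a, b, h⟩⟩
    · exact ⟨r, Or.inr (Or.inl ⟨a, b, c, h⟩)⟩
    · exact ⟨r, Or.inr (Or.inr ⟨a, b, c, h⟩)⟩
  · rintro ⟨r, ⟨a, b, h⟩ | ⟨a, b, c, h⟩ | ⟨a, b, c, h⟩⟩
    · exact Or.inl ⟨a, b, r, h⟩
    · exact Or.inr (Or.inl ⟨a, b, c, r, h⟩)
    · exact Or.inr (Or.inr ⟨a, b, c, r, h⟩)

/-- The degree conditions leave a non-root vertex no neighbours outside its pendant subgraph. -/
theorem IsNonRootOf.adj {v r w : V} (h : IsNonRootOf H v r) (hw : H.Adj v w) :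
    w = r ∨ IsNonRootOf H w r := by
  rcases h with ⟨a, b, h, hv⟩ | ⟨a, b, c, h, hv⟩ | ⟨a, b, c, h, hv⟩
  · have key : w = r ∨ w = a ∨ w = b := by
      rcases hv with rfl | rfl
      · have := h.adj_a hw; grind
      · have := h.adj_b hw; grind
    exact key.imp_right fun hw => Or.inl ⟨a, b, h, hw⟩
  · have key : w = r ∨ w = a ∨ w = b ∨ w = c := by
      rcases hv with rfl | rfl | rfl
      · have := h.adj_a hw; grind
      · have := h.adj_b hw; grind
      · have := h.adj_c hw; grind
    exact key.imp_right fun hw => Or.inr (Or.inl ⟨a, b, c, h, hw⟩)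
  · have key : w = r ∨ w = a ∨ w = b ∨ w = c := by
      rcases hv with rfl | rfl | rfl
      · have := h.adj_a hw; grind
      · have := h.rotate.adj_a hw; grind
      · have := h.rotate.rotate.adj_a hw; grind
    exact key.imp_right fun hw => Or.inr (Or.inr ⟨a, b, c, h, hw⟩)

theorem IsNonRootOf.root_mem {v r : V} (h : IsNonRootOf H v r) :
    r ∈ triangleRoots H ∨ r ∈ diamondRoots H ∪ k4Roots H := by
  rcases h with ⟨a, b, h, -⟩ | ⟨a, b, c, h, -⟩ | ⟨a, b, c, h, -⟩
  · exact Or.inl ⟨a, b, h⟩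
  · exact Or.inr (Or.inl ⟨a, b, c, h⟩)
  · exact Or.inr (Or.inr ⟨a, b, c, h⟩)

theorem not_isUnavoidable_of_mem_pendantNonRoots {v : V} (hv : v ∈ pendantNonRoots H) :
    ¬ IsUnavoidable H v := by
  rcases hv with ⟨a, b, r, h, rfl | rfl⟩ | ⟨a, b, c, r, h, rfl | rfl | rfl⟩ |
    ⟨a, b, c, r, h, rfl | rfl | rfl⟩
  · exact h.not_isUnavoidable
  · exact h.swap.not_isUnavoidable
  · exact h.not_isUnavoidable_a
  · exact h.not_isUnavoidable_b
  · exact h.swap.not_isUnavoidable_b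
  · exact h.not_isUnavoidable
  · exact h.rotate.not_isUnavoidable
  · exact h.rotate.rotate.not_isUnavoidable

/-- A triangle root has degree above 2 and two neighbours of degree 2. Non-root vertices of degree 3
have at most one such neighbour: the tip, in a diamond, and none in a `K₄`. -/
theorem notMem_pendantNonRoots_of_mem_triangleRoots {r : V} (hr : r ∈ triangleRoots H) :
    r ∉ pendantNonRoots H := by
  obtain ⟨a, b, h⟩ := hr
  have hdeg := h.deg_c
  have ha := h.deg_a
  have hb := h.deg_b
  have hne := h.ab.ne
  rintro (⟨a', b', r', h', rfl | rfl⟩ | ⟨a', b', c', r', h', hv⟩ | ⟨a', b', c', r', h', hv⟩)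
  · have := h'.deg_a; omega
  · have := h'.deg_b; omega
  · have d₁ := h'.deg_a
    have d₂ := h'.deg_b
    have d₃ := h'.deg_c
    have d₄ := h'.deg_d
    rcases hv with rfl | rfl | rfl
    · omega
    · have := h'.adj_b h.ac.symm
      have := h'.adj_b h.bc.symm
      grind
    · have := h'.adj_c h.ac.symm
      have := h'.adj_c h.bc.symm
      grind
  · have d₁ := h'.deg_a
    have d₂ := h'.deg_b
    have d₃ := h'.deg_c
    have d₄ := h'.deg_d
    rcases hv with rfl | rfl | rfl
    · have := h'.adj_a h.ac.symm
      grind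
    · have := h'.rotate.adj_a h.ac.symm
      grind
    · have := h'.rotate.rotate.adj_a h.ac.symm
      grind

theorem IsPendantCore.exists_isStrongTriangle {s : Set V} (h : IsPendantCore H s) :
    ∃ a b c, s = {a, b, c} ∧ IsStrongTriangle H a b c := by
  obtain ⟨a, b, c, rfl, h | ⟨d, h⟩ | ⟨d, h⟩⟩ := h
  · exact ⟨a, b, c, rfl, h.isStrongTriangle⟩
  · exact ⟨a, b, c, rfl, h.isStrongTriangle⟩
  · exact ⟨a, b, c, rfl, h.isStrongTriangle⟩

theorem IsPendantCore.isClique {s : Set V} (h : IsPendantCore H s) : H.IsClique s := by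
  obtain ⟨a, b, c, rfl, ht⟩ := h.exists_isStrongTriangle
  have h₁ := ht.ab
  have h₂ := ht.ac
  have h₃ := ht.bc
  rintro x (rfl | rfl | rfl) y (rfl | rfl | rfl) hne <;>
    first
      | exact absurd rfl hne
      | assumption
      | (apply SimpleGraph.Adj.symm; assumption)

theorem IsPendantCore.mem_pendantNonRoots_or_mem_triangleRoots {s : Set V}
    (h : IsPendantCore H s) {x : V} (hx : x ∈ s) :
    x ∈ pendantNonRoots H ∨ x ∈ triangleRoots H := by
  obtain ⟨a, b, c, rfl, h | ⟨d, h⟩ | ⟨d, h⟩⟩ := h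
  · rcases hx with rfl | rfl | rfl
    · exact Or.inl (Or.inl ⟨_, _, _, h, Or.inl rfl⟩)
    · exact Or.inl (Or.inl ⟨_, _, _, h, Or.inr rfl⟩)
    · exact Or.inr ⟨_, _, h⟩
  · exact Or.inl (Or.inr (Or.inl ⟨a, b, c, d, h, hx⟩))
  · exact Or.inl (Or.inr (Or.inr ⟨a, b, c, d, h, hx⟩))

theorem IsPendantCore.mem_pendantNonRoots_or {s : Set V} (h : IsPendantCore H s) {x y : V}
    (hx : x ∈ s) (hy : y ∈ s) (hxy : x ≠ y) :
    x ∈ pendantNonRoots H ∨ y ∈ pendantNonRoots H := by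
  obtain ⟨a, b, c, rfl, h | ⟨d, h⟩ | ⟨d, h⟩⟩ := h
  · rcases hx with rfl | rfl | rfl
    · exact Or.inl (Or.inl ⟨_, _, _, h, Or.inl rfl⟩)
    · exact Or.inl (Or.inl ⟨_, _, _, h, Or.inr rfl⟩)
    · rcases hy with rfl | rfl | rfl
      · exact Or.inr (Or.inl ⟨_, _, _, h, Or.inl rfl⟩)
      · exact Or.inr (Or.inl ⟨_, _, _, h, Or.inr rfl⟩)
      · exact absurd rfl hxy
  · exact Or.inl (Or.inr (Or.inl ⟨a, b, c, d, h, hx⟩))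
  · exact Or.inl (Or.inr (Or.inr ⟨a, b, c, d, h, hx⟩))

/-- A pendant triangle is its own core, root included; only in a diamond or a `K₄` does the root lie
outside the core. Thus every edge at a non-root vertex lies in a core or in the star of such a root.
-/
theorem IsPendantCore.adj {s : Set V} (h : IsPendantCore H s) {x y : V}
    (hx : x ∈ s) (hxN : x ∈ pendantNonRoots H) (hxy : H.Adj x y) :
    y ∈ s ∨ y ∈ diamondRoots H ∪ k4Roots H := by
  obtain ⟨a, b, c, rfl, h | ⟨d, h⟩ | ⟨d, h⟩⟩ := h
  · left
    simp only [Set.mem_insert_iff, Set.mem_singleton_iff]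
    rcases hx with rfl | rfl | rfl
    · have := h.adj_a hxy; grind
    · have := h.adj_b hxy; grind
    · exact absurd hxN (notMem_pendantNonRoots_of_mem_triangleRoots ⟨_, _, h⟩)
  · have key : y ∈ ({a, b, c} : Set V) ∨ y = d := by
      simp only [Set.mem_insert_iff, Set.mem_singleton_iff]
      rcases hx with rfl | rfl | rfl
      · have := h.adj_a hxy; grind
      · have := h.adj_b hxy; grind
      · have := h.adj_c hxy; grind
    exact key.imp_right (by rintro rfl; exact Or.inl ⟨a, b, c, h⟩)
  · have key : y ∈ ({a, b, c} : Set V) ∨ y = d := by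
      simp only [Set.mem_insert_iff, Set.mem_singleton_iff]
      rcases hx with rfl | rfl | rfl
      · have := h.adj_a hxy; grind
      · have := h.rotate.adj_a hxy; grind
      · have := h.rotate.rotate.adj_a hxy; grind
    exact key.imp_right (by rintro rfl; exact Or.inr ⟨a, b, c, h⟩)

theorem exists_isPendantCore {v : V} (hv : v ∈ pendantNonRoots H) :
    ∃ s, IsPendantCore H s ∧ v ∈ s := by
  rcases hv with ⟨a, b, r, h, hv⟩ | ⟨a, b, c, r, h, hv⟩ | ⟨a, b, c, r, h, hv⟩
  · exact ⟨{a, b, r}, ⟨a, b, r, rfl, Or.inl h⟩, hv.imp_right Or.inl⟩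
  · exact ⟨{a, b, c}, ⟨a, b, c, rfl, Or.inr (Or.inl ⟨r, h⟩)⟩, hv⟩
  · exact ⟨{a, b, c}, ⟨a, b, c, rfl, Or.inr (Or.inr ⟨r, h⟩)⟩, hv⟩

end Pendant

/-! ### Recognizing the small exceptional graphs -/

/-- A nonempty vertex set of a connected graph that is closed under adjacency is everything. -/
theorem mem_of_connected {H : SimpleGraph V} (hH : H.Preconnected) {A : Set V}
    (hA : ∀ u ∈ A, ∀ w, H.Adj u w → w ∈ A) {u : V} (hu : u ∈ A) (w : V) : w ∈ A := by
  obtain ⟨p⟩ := hH u w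
  induction p with
  | nil => exact hu
  | cons h _ ih => exact ih (hA _ hu _ h)

theorem nonempty_iso_of_bijective {n : ℕ} {G : SimpleGraph (Fin n)} {H : SimpleGraph V}
    (f : Fin n → V) (hf : Function.Bijective f) (h : ∀ i j, H.Adj (f i) (f j) ↔ G.Adj i j) :
    Nonempty (H ≃g G) :=
  ⟨(⟨Equiv.ofBijective f hf, fun {i j} => h i j⟩ : G ≃g H).symm⟩

theorem nonempty_iso_completeGraph_three {H : SimpleGraph V} {a b c : V} (hab : H.Adj a b)
    (hac : H.Adj a c) (hbc : H.Adj b c) (hV : ∀ v, v = a ∨ v = b ∨ v = c) :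
    Nonempty (H ≃g SimpleGraph.completeGraph (Fin 3)) := by
  refine nonempty_iso_of_bijective ![a, b, c] ⟨?_, ?_⟩ ?_
  · intro i j h
    fin_cases i <;> fin_cases j <;> simp_all [hab.ne, hac.ne, hbc.ne, hab.ne', hac.ne', hbc.ne']
  · intro v
    rcases hV v with rfl | rfl | rfl
    exacts [⟨0, rfl⟩, ⟨1, rfl⟩, ⟨2, rfl⟩]
  · intro i j
    fin_cases i <;> fin_cases j <;> simp [hab, hac, hbc, hab.symm, hac.symm, hbc.symm]

theorem nonempty_iso_completeGraph_four {H : SimpleGraph V} {a b c d : V} (hab : H.Adj a b)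
    (hac : H.Adj a c) (had : H.Adj a d) (hbc : H.Adj b c) (hbd : H.Adj b d) (hcd : H.Adj c d)
    (hV : ∀ v, v = a ∨ v = b ∨ v = c ∨ v = d) :
    Nonempty (H ≃g SimpleGraph.completeGraph (Fin 4)) := by
  have h₁ := hab.ne
  have h₂ := hac.ne
  have h₃ := had.ne
  have h₄ := hbc.ne
  have h₅ := hbd.ne
  have h₆ := hcd.ne
  refine nonempty_iso_of_bijective ![a, b, c, d] ⟨?_, ?_⟩ ?_
  · intro i j h
    fin_cases i <;> fin_cases j <;> simp at h ⊢ <;> grind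
  · intro v
    rcases hV v with rfl | rfl | rfl | rfl
    exacts [⟨0, rfl⟩, ⟨1, rfl⟩, ⟨2, rfl⟩, ⟨3, rfl⟩]
  · intro i j
    fin_cases i <;> fin_cases j <;>
      simp [hab, hac, had, hbc, hbd, hcd, hab.symm, hac.symm, had.symm, hbc.symm, hbd.symm,
        hcd.symm]

theorem nonempty_iso_diamond {H : SimpleGraph V} {a b c d : V} (hab : H.Adj a b)
    (hac : H.Adj a c) (had : ¬ H.Adj a d) (had' : a ≠ d) (hbc : H.Adj b c) (hbd : H.Adj b d)
    (hcd : H.Adj c d) (hV : ∀ v, v = a ∨ v = b ∨ v = c ∨ v = d) :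
    Nonempty (H ≃g diamond) := by
  have h₁ := hab.ne
  have h₂ := hac.ne
  have h₄ := hbc.ne
  have h₅ := hbd.ne
  have h₆ := hcd.ne
  refine nonempty_iso_of_bijective ![a, b, c, d] ⟨?_, ?_⟩ ?_
  · intro i j h
    fin_cases i <;> fin_cases j <;> simp at h ⊢ <;> grind
  · intro v
    rcases hV v with rfl | rfl | rfl | rfl
    exacts [⟨0, rfl⟩, ⟨1, rfl⟩, ⟨2, rfl⟩, ⟨3, rfl⟩]
  · have had'' : ¬ H.Adj d a := fun h => had h.symm
    intro i j
    fin_cases i <;> fin_cases j <;>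
      simp [diamond, hab, hac, had, had'', hbc, hbd, hcd, hab.symm, hac.symm, hbc.symm, hbd.symm,
        hcd.symm]

end LocalizableGraph

/-! ### Edge covers of localizable line graphs, and the cases `K₃`, `K₄` and diamond -/

namespace LocalizableGraph

variable {V : Type*}

/-- The edges of a localizable line graph are covered by disjoint stars and strong triangles. -/
theorem IsLocalizable.exists_cover [Finite V] {H : SimpleGraph V}
    (h : IsLocalizable H.lineGraph) :
    ∃ (S : Set V) (T : Set (Set V)), (∀ v ∈ S, IsUnavoidable H v) ∧
      (∀ u ∈ S, ∀ v ∈ S, ¬ H.Adj u v) ∧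
      (∀ v ∈ S, ∀ s ∈ T, v ∉ s) ∧
      (∀ s ∈ T, ∀ t ∈ T, ∀ x y, H.Adj x y → x ∈ s → y ∈ s → x ∈ t → y ∈ t → s ⊆ t) ∧
      ∀ x y, H.Adj x y → x ∈ S ∨ y ∈ S ∨ ∃ z, IsStrongTriangle H x y z ∧ {x, y, z} ∈ T := by
  obtain ⟨P, ⟨-, hpart⟩, hP⟩ := h
  have huniq : ∀ C ∈ P, ∀ D ∈ P, ∀ e, e ∈ C → e ∈ D → C = D := fun C hC D hD e heC heD =>
    (hpart e).unique ⟨hC, heC⟩ ⟨hD, heD⟩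
  -- One centre is chosen per star: both ends of an isolated edge have the same star, and taking
  -- both would destroy independence of `S`.
  let S : Set V := {v | ∃ C ∈ P, ∃ h : (∃ v, C = star H v ∧ IsUnavoidable H v), v = h.choose}
  have hS : ∀ v ∈ S, star H v ∈ P ∧ IsUnavoidable H v := by
    rintro _ ⟨C, hC, h, rfl⟩
    exact ⟨h.choose_spec.1 ▸ hC, h.choose_spec.2⟩
  -- The side `xy` opposite `v` distinguishes the triangle from the star at `v`; the side `vx` shows
  -- that `v` can be recovered from the edge set.
  have hfar : ∀ s, ∀ v ∈ s, (∃ a b c, s = {a, b, c} ∧ IsStrongTriangle H a b c) →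
      ∃ x y, ∃ h : H.Adj x y, x ≠ v ∧ y ≠ v ∧ (⟨s(x, y), h⟩ : H.edgeSet) ∈ edgesIn H s ∧
        ∃ h : H.Adj v x, (⟨s(v, x), h⟩ : H.edgeSet) ∈ edgesIn H s := by
    rintro _ v hv ⟨a, b, c, rfl, h⟩
    rcases hv with rfl | rfl | rfl
    · exact ⟨b, c, h.bc, h.ab.ne', h.ac.ne', (mk_mem_edgesIn _).2 (by simp), h.ab,
        (mk_mem_edgesIn _).2 (by simp)⟩
    · exact ⟨a, c, h.ac, h.ab.ne, h.bc.ne', (mk_mem_edgesIn _).2 (by simp), h.ab.symm,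
        (mk_mem_edgesIn _).2 (by simp)⟩
    · exact ⟨a, b, h.ab, h.ac.ne, h.bc.ne, (mk_mem_edgesIn _).2 (by simp), h.ac.symm,
        (mk_mem_edgesIn _).2 (by simp)⟩
  refine ⟨S, {s | edgesIn H s ∈ P ∧ ∃ a b c, s = {a, b, c} ∧ IsStrongTriangle H a b c},
    fun v hv => (hS v hv).2, ?_, ?_, ?_, ?_⟩
  · rintro u ⟨C, hC, h, rfl⟩ v ⟨D, hD, h', rfl⟩ hadj
    obtain rfl : C = D := by
      refine huniq C hC D hD ⟨s(h.choose, h'.choose), hadj⟩ ?_ ?_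
      · have := h.choose_spec.1
        generalize h.choose = u at *
        subst this
        exact (mk_mem_star _).2 (Or.inl rfl)
      · have := h'.choose_spec.1
        generalize h'.choose = u at *
        subst this
        exact (mk_mem_star _).2 (Or.inr rfl)
    exact hadj.ne rfl
  · rintro v hv s ⟨hs, habc⟩ hvs
    obtain ⟨x, y, hxy, hxv, hyv, hin, hvx, hin'⟩ := hfar s v hvs habc
    have heq := huniq _ hs _ (hS v hv).1 _ hin' ((mk_mem_star _).2 (Or.inl rfl))
    rw [heq] at hin
    rcases (mk_mem_star _).1 hin with rfl | rfl
    · exact hxv rfl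
    · exact hyv rfl
  · rintro s ⟨hs, habc⟩ t ⟨ht, -⟩ x y hxy hxs hys hxt hyt v hv
    obtain ⟨z, -, -, -, -, -, hvz, hin'⟩ := hfar s v hv habc
    have heq := huniq _ hs _ ht ⟨s(x, y), hxy⟩ ((mk_mem_edgesIn _).2 ⟨hxs, hys⟩)
      ((mk_mem_edgesIn _).2 ⟨hxt, hyt⟩)
    rw [heq] at hin'
    exact ((mk_mem_edgesIn _).1 hin').1
  · intro x y hxy
    obtain ⟨C, ⟨hC, hxyC⟩, -⟩ := hpart ⟨s(x, y), hxy⟩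
    rcases (hP C hC).eq_star_or_eq_triangle with h | ⟨a, b, c, rfl, h⟩
    · have hmem : h.choose ∈ S := ⟨C, hC, h, rfl⟩
      have hspec := h.choose_spec.1
      generalize h.choose = v at *
      subst hspec
      rcases (mk_mem_star _).1 hxyC with rfl | rfl
      · exact Or.inl hmem
      · exact Or.inr (Or.inl hmem)
    · refine Or.inr (Or.inr ?_)
      have hne := hxy.ne
      have hxyC := (mk_mem_edgesIn _).1 hxyC
      have key : ∀ p q r, ({p, q, r} : Set V) = {a, b, c} → IsStrongTriangle H p q r →
          ∃ z, IsStrongTriangle H p q z ∧ ({p, q, z} : Set V) ∈ {s | edgesIn H s ∈ P ∧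
            ∃ a b c, s = {a, b, c} ∧ IsStrongTriangle H a b c} := by
        intro p q r heq hr
        exact ⟨r, hr, by rw [heq]; exact hC, _, _, _, rfl, hr⟩
      rcases hxyC with ⟨rfl | rfl | rfl, rfl | rfl | rfl⟩
      · exact absurd rfl hne
      · exact key _ _ _ rfl h
      · exact key _ _ b (by grind) h.rotate.swap.rotate.rotate
      · exact key _ _ _ (by grind) h.swap
      · exact absurd rfl hne
      · exact key _ _ _ (by grind) h.rotate
      · exact key _ _ _ (by grind) h.rotate.rotate
      · exact key _ _ _ (by grind) h.rotate.swap
      · exact absurd rfl hne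

/-- The matching `{bc}` shows that the tips are not strong. As `b` and `c` are adjacent, they are
not both star centres, so `ab` or `ac` forces the triangle `abc` into the cover. Then `b` is no
centre, and `db` forces `dbc`, which shares the side `bc` with `abc`. -/
theorem not_isLocalizable_diamond [Finite V] {H : SimpleGraph V} {a b c d : V}
    (hab : H.Adj a b) (hac : H.Adj a c) (hbc : H.Adj b c) (hbd : H.Adj b d) (hcd : H.Adj c d)
    (hne : a ≠ d) (ha : ∀ x, H.Adj a x → x = b ∨ x = c) (hd : ∀ x, H.Adj d x → x = b ∨ x = c) :
    ¬ IsLocalizable H.lineGraph := by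
  intro h
  obtain ⟨S, T, hS, hSS, hST, hTT, hcover⟩ := h.exists_cover
  have haS : a ∉ S := fun h => not_isUnavoidable_of_edge hbc hab.ne hac.ne ha (hS a h)
  have hdS : d ∉ S := fun h => not_isUnavoidable_of_edge hbc hbd.ne' hcd.ne' hd (hS d h)
  have hab' : b ∈ S ∨ {a, b, c} ∈ T := by
    rcases hcover a b hab with h | h | ⟨z, hz, hzT⟩
    · exact absurd h haS
    · exact Or.inl h
    · rcases ha z hz.ac with rfl | rfl
      · exact absurd rfl hz.bc.ne
      · exact Or.inr hzT
  have hac' : c ∈ S ∨ {a, b, c} ∈ T := by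
    rcases hcover a c hac with h | h | ⟨z, hz, hzT⟩
    · exact absurd h haS
    · exact Or.inl h
    · rcases ha z hz.ac with rfl | rfl
      · exact Or.inr (Set.pair_comm c z ▸ hzT)
      · exact absurd rfl hz.bc.ne
  have hT : {a, b, c} ∈ T := by
    rcases hab' with hb | h
    · rcases hac' with hc | h
      · exact absurd hbc (hSS b hb c hc)
      · exact h
    · exact h
  have hbS : b ∉ S := fun h => hST b h _ hT (by simp)
  have hbd' : {d, b, c} ∈ T := by
    rcases hcover d b hbd.symm with h | h | ⟨z, hz, hzT⟩
    · exact absurd h hdS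
    · exact absurd h hbS
    · rcases hd z hz.ac with rfl | rfl
      · exact absurd rfl hz.bc.ne
      · exact hzT
  have := hTT _ hT _ hbd' b c hbc (by simp) (by simp) (by simp) (by simp)
    (show a ∈ ({a, b, c} : Set V) by simp)
  rcases this with rfl | rfl | rfl
  · exact hne rfl
  · exact hab.ne rfl
  · exact hac.ne rfl

theorem not_isLocalizable_of_iso_diamond [Finite V] {H : SimpleGraph V}
    (h : Nonempty (H ≃g diamond)) : ¬ IsLocalizable H.lineGraph := by
  obtain ⟨φ⟩ := h
  have hadj : ∀ i j, H.Adj (φ.symm i) (φ.symm j) ↔ diamond.Adj i j := fun i j =>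
    φ.symm.map_adj_iff
  have hnbr : ∀ i x, H.Adj (φ.symm i) x → diamond.Adj i (φ x) := fun i x hx => by
    rw [← hadj, φ.symm_apply_apply]
    exact hx
  have hval : ∀ i x, φ x = i → x = φ.symm i := by
    rintro _ x rfl
    exact (φ.symm_apply_apply x).symm
  refine not_isLocalizable_diamond (a := φ.symm 0) (b := φ.symm 1) (c := φ.symm 2)
    (d := φ.symm 3) ((hadj _ _).2 ?_) ((hadj _ _).2 ?_) ((hadj _ _).2 ?_) ((hadj _ _).2 ?_)
    ((hadj _ _).2 ?_) (φ.symm.injective.ne (by decide)) ?_ ?_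
  · simp [diamond]
  · simp [diamond]
  · simp [diamond]
  · simp [diamond]
  · simp [diamond]
  · intro x hx
    have := hnbr _ _ hx
    have hx' : φ x = 1 ∨ φ x = 2 := by
      generalize φ x = i at *
      fin_cases i <;> simp [diamond] at this ⊢
    exact hx'.imp (hval _ _) (hval _ _)
  · intro x hx
    have := hnbr _ _ hx
    have hx' : φ x = 1 ∨ φ x = 2 := by
      generalize φ x = i at *
      fin_cases i <;> simp [diamond] at this ⊢
    exact hx'.imp (hval _ _) (hval _ _)

/-- A matching that misses `d` and covers `a`, `b`, `c` would pair these three vertices among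
themselves, which parity forbids. -/
theorem isUnavoidable_of_k4 {H : SimpleGraph V} {a b c d : V} (had : H.Adj d a)
    (hbd : H.Adj d b) (hcd : H.Adj d c) (hab : a ≠ b) (hac : a ≠ c) (hbc : b ≠ c)
    (ha : ∀ x, H.Adj a x → x = b ∨ x = c ∨ x = d) (hb : ∀ x, H.Adj b x → x = c ∨ x = a ∨ x = d)
    (hc : ∀ x, H.Adj c x → x = a ∨ x = b ∨ x = d) : IsUnavoidable H d := by
  intro N hN hp hd
  by_contra! hcon
  obtain ⟨x, hx⟩ := hcon a had
  obtain ⟨y, hy⟩ := hcon b hbd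
  obtain ⟨z, hz⟩ := hcon c hcd
  have hd' : ∀ x, ¬ N.Adj x d := fun x hx => hd x hx.symm
  have inj : ∀ p q r, N.Adj p r → N.Adj q r → p = q := fun p q r h₁ h₂ => hp h₁.symm h₂.symm
  have hx' := ha x (hN hx)
  have hy' := hb y (hN hy)
  have hz' := hc z (hN hz)
  have hxs := hx.symm
  have hys := hy.symm
  have hzs := hz.symm
  have hxd : x ≠ d := by rintro rfl; exact hd' _ hx
  have hyd : y ≠ d := by rintro rfl; exact hd' _ hy
  have hzd : z ≠ d := by rintro rfl; exact hd' _ hz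
  have i₁ : x ≠ y := by rintro rfl; exact hab (inj _ _ _ hx hy)
  have i₂ : x ≠ z := by rintro rfl; exact hac (inj _ _ _ hx hz)
  have i₃ : y ≠ z := by rintro rfl; exact hbc (inj _ _ _ hy hz)
  have j₁ : x = b → y = a := by rintro rfl; exact hp hy hxs
  have j₂ : x = c → z = a := by rintro rfl; exact hp hz hxs
  have j₃ : y = c → z = b := by rintro rfl; exact hp hz hys
  grind

theorem isLocalizable_of_iso_completeGraph_three [Finite V] {H : SimpleGraph V}
    (h : Nonempty (H ≃g SimpleGraph.completeGraph (Fin 3))) : IsLocalizable H.lineGraph := by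
  obtain ⟨φ⟩ := h
  have hadj : ∀ i j, i ≠ j → H.Adj (φ.symm i) (φ.symm j) := fun i j h => φ.symm.map_adj_iff.2 h
  have hV : ∀ v, v = φ.symm 0 ∨ v = φ.symm 1 ∨ v = φ.symm 2 := by
    intro v
    obtain ⟨i, rfl⟩ := φ.symm.surjective v
    fin_cases i <;> simp
  refine isLocalizable_of_cover H ∅ {Set.univ} (by simp) (by simp) ?_ (by simp) ?_ (by simp)
  · rintro s rfl
    refine ⟨φ.symm 0, φ.symm 1, φ.symm 2, (Set.eq_univ_of_forall hV).symm,
      hadj _ _ (by decide), hadj _ _ (by decide), hadj _ _ (by decide), ?_, ?_, ?_⟩ <;>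
    · intro x y h₁ h₂ h₃ h₄ h₅ h₆
      have := h₅.ne
      have := h₆.ne
      have := hV x
      grind
  · rintro s rfl t rfl
    simp

theorem isLocalizable_of_iso_completeGraph_four [Finite V] {H : SimpleGraph V}
    (h : Nonempty (H ≃g SimpleGraph.completeGraph (Fin 4))) : IsLocalizable H.lineGraph := by
  obtain ⟨φ⟩ := h
  have hadj : ∀ i j, i ≠ j → H.Adj (φ.symm i) (φ.symm j) := fun i j h => φ.symm.map_adj_iff.2 h
  have h₀₁ := hadj 0 1 (by decide)
  have h₀₂ := hadj 0 2 (by decide)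
  have h₀₃ := hadj 0 3 (by decide)
  have h₁₂ := hadj 1 2 (by decide)
  have h₁₃ := hadj 1 3 (by decide)
  have h₂₃ := hadj 2 3 (by decide)
  have hV : ∀ v, v = φ.symm 0 ∨ v = φ.symm 1 ∨ v = φ.symm 2 ∨ v = φ.symm 3 := by
    intro v
    obtain ⟨i, rfl⟩ := φ.symm.surjective v
    fin_cases i <;> simp
  generalize φ.symm 0 = a at *
  generalize φ.symm 1 = b at *
  generalize φ.symm 2 = c at *
  generalize φ.symm 3 = d at *
  -- `K₄` splits into one star and the opposite triangle.
  refine isLocalizable_of_cover H {d} {{a, b, c}} ?_ (by simp) ?_ ?_ ?_ ?_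
  · rintro v rfl
    refine isUnavoidable_of_k4 h₀₃.symm h₁₃.symm h₂₃.symm h₀₁.ne h₀₂.ne h₁₂.ne ?_ ?_ ?_ <;>
    · intro x hx
      have := hx.ne
      have := hV x
      grind
  · rintro s rfl
    refine ⟨a, b, c, rfl, h₀₁, h₀₂, h₁₂, ?_, ?_, ?_⟩ <;>
    · intro x y h₁ h₂ h₃ h₄ h₅ h₆
      have := h₅.ne
      have := h₆.ne
      have := hV x
      have := hV y
      grind
  · rintro v rfl s rfl
    simp [h₀₃.ne', h₁₃.ne', h₂₃.ne']
  · rintro s rfl t rfl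
    simp
  · intro x y hxy
    have := hxy.ne
    have := hV x
    have := hV y
    simp only [Set.mem_singleton_iff, exists_eq_left, Set.mem_insert_iff]
    grind

end LocalizableGraph

/-! ### Strong triangles are pendant cores; properties of the pendant reduction -/

namespace LocalizableGraph

variable {V : Type*} [Fintype V] {H : SimpleGraph V} [DecidableRel H.Adj] {a b c d : V}

theorem IsStrongTriangle.isPendantTriangle_or_iso (hH : H.Connected)
    (h : IsStrongTriangle H a b c) (ha : ∀ x, H.Adj a x → x = b ∨ x = c)
    (hb : ∀ x, H.Adj b x → x = a ∨ x = c) :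
    IsPendantTriangle H a b c ∨ Nonempty (H ≃g SimpleGraph.completeGraph (Fin 3)) := by
  by_cases hc : ∃ x, H.Adj c x ∧ x ≠ a ∧ x ≠ b
  · exact Or.inl ⟨h.ab, h.ac, h.bc, (degree_eq_two_iff h.ab h.ac h.bc.ne).2 ha,
      (degree_eq_two_iff h.ab.symm h.bc h.ac.ne).2 hb,
      (two_lt_degree_iff h.ac.symm h.bc.symm h.ab.ne).2 hc⟩
  · right
    refine nonempty_iso_completeGraph_three h.ab h.ac h.bc fun v => ?_
    refine mem_of_connected hH.preconnected (A := {v | v = a ∨ v = b ∨ v = c}) ?_ (Or.inl rfl) v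
    rintro u (rfl | rfl | rfl) w hw
    · exact Or.inr (ha w hw)
    · exact (hb w hw).imp_right Or.inr
    · change w = a ∨ w = b ∨ w = u
      grind

/-- Strength makes all outer neighbours of `b` and `c` one vertex `d`. Either `d` has a further
neighbour, or `{a, b, c, d}` is closed under adjacency and is all of `H`. -/
theorem IsStrongTriangle.isPendantDiamond_or_iso (hH : H.Connected)
    (h : IsStrongTriangle H a b c) (ha : ∀ x, H.Adj a x → x = b ∨ x = c)
    (hb : ∃ x, H.Adj b x ∧ x ≠ a ∧ x ≠ c) (hc : ∃ x, H.Adj c x ∧ x ≠ a ∧ x ≠ b) :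
    (∃ d, IsPendantDiamond H a b c d) ∨ Nonempty (H ≃g diamond) := by
  obtain ⟨d, hbd, hda, hdc⟩ := hb
  obtain ⟨d', hcd, hda', hdb⟩ := hc
  obtain rfl := h.out_bc d d' hda hdc hda' hdb hbd hcd
  have had : ¬ H.Adj a d := fun h => by
    rcases ha d h with rfl | rfl
    · exact hdb rfl
    · exact hdc rfl
  have hb' : ∀ x, H.Adj b x → x = a ∨ x = c ∨ x = d := fun x hx => by
    by_contra! hcon
    exact hcon.2.2 (h.out_bc x d hcon.1 hcon.2.1 hda hdb hx hcd)
  have hc' : ∀ x, H.Adj c x → x = a ∨ x = b ∨ x = d := fun x hx => by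
    by_contra! hcon
    exact hcon.2.2 (h.out_bc d x hda hdc hcon.1 hcon.2.1 hbd hx).symm
  by_cases hd : ∃ x, H.Adj d x ∧ x ≠ b ∧ x ≠ c
  · exact Or.inl ⟨d, h.ab, h.ac, h.bc, hbd, hcd, hda.symm, had,
      (degree_eq_two_iff h.ab h.ac h.bc.ne).2 ha,
      (degree_eq_three_iff h.ab.symm h.bc hbd h.ac.ne hda.symm hcd.ne).2 hb',
      (degree_eq_three_iff h.ac.symm h.bc.symm hcd h.ab.ne hda.symm hbd.ne).2 hc',
      (two_lt_degree_iff hbd.symm hcd.symm h.bc.ne).2 hd⟩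
  · right
    refine nonempty_iso_diamond h.ab h.ac had hda.symm h.bc hbd hcd fun v => ?_
    refine mem_of_connected hH.preconnected (A := {v | v = a ∨ v = b ∨ v = c ∨ v = d}) ?_
      (Or.inl rfl) v
    rintro u hu w hw
    change w = a ∨ w = b ∨ w = c ∨ w = d
    rcases hu with rfl | rfl | rfl | rfl
    · have := ha w hw; grind
    · have := hb' w hw; grind
    · have := hc' w hw; grind
    · grind

theorem IsStrongTriangle.isPendantK4_or_iso (hH : H.Connected)
    (h : IsStrongTriangle H a b c) (ha : ∃ x, H.Adj a x ∧ x ≠ b ∧ x ≠ c)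
    (hb : ∃ x, H.Adj b x ∧ x ≠ a ∧ x ≠ c) (hc : ∃ x, H.Adj c x ∧ x ≠ a ∧ x ≠ b) :
    (∃ d, IsPendantK4 H a b c d) ∨ Nonempty (H ≃g SimpleGraph.completeGraph (Fin 4)) := by
  obtain ⟨d, hbd, hda, hdc⟩ := hb
  obtain ⟨d', hcd, hda', hdb⟩ := hc
  obtain rfl := h.out_bc d d' hda hdc hda' hdb hbd hcd
  obtain ⟨d', had, hdb', hdc'⟩ := ha
  obtain rfl := h.out_ab d' d hdb' hdc' hda hdc had hbd
  have ha' : ∀ x, H.Adj a x → x = b ∨ x = c ∨ x = d' := fun x hx => by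
    by_contra! hcon
    exact hcon.2.2 (h.out_ab x d' hcon.1 hcon.2.1 hda hdc hx hbd)
  have hb' : ∀ x, H.Adj b x → x = a ∨ x = c ∨ x = d' := fun x hx => by
    by_contra! hcon
    exact hcon.2.2 (h.out_bc x d' hcon.1 hcon.2.1 hda hdb hx hcd)
  have hc' : ∀ x, H.Adj c x → x = a ∨ x = b ∨ x = d' := fun x hx => by
    by_contra! hcon
    exact hcon.2.2 (h.out_bc d' x hda hdc hcon.1 hcon.2.1 hbd hx).symm
  by_cases hd : ∃ x, H.Adj d' x ∧ x ≠ a ∧ x ≠ b ∧ x ≠ c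
  · exact Or.inl ⟨d', h.ab, h.ac, had, h.bc, hbd, hcd,
      (degree_eq_three_iff h.ab h.ac had h.bc.ne hbd.ne hcd.ne).2 ha',
      (degree_eq_three_iff h.ab.symm h.bc hbd h.ac.ne had.ne hcd.ne).2 hb',
      (degree_eq_three_iff h.ac.symm h.bc.symm hcd h.ab.ne had.ne hbd.ne).2 hc',
      (three_lt_degree_iff had.symm hbd.symm hcd.symm h.ab.ne h.ac.ne h.bc.ne).2 hd⟩
  · right
    refine nonempty_iso_completeGraph_four h.ab h.ac had h.bc hbd hcd fun v => ?_
    refine mem_of_connected hH.preconnected (A := {v | v = a ∨ v = b ∨ v = c ∨ v = d'}) ?_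
      (Or.inl rfl) v
    rintro u hu w hw
    change w = a ∨ w = b ∨ w = c ∨ w = d'
    rcases hu with rfl | rfl | rfl | rfl
    · have := ha' w hw; grind
    · have := hb' w hw; grind
    · have := hc' w hw; grind
    · grind

theorem IsStrongTriangle.isPendantCore (hH : H.Connected)
    (h3 : ¬ Nonempty (H ≃g SimpleGraph.completeGraph (Fin 3)))
    (h4 : ¬ Nonempty (H ≃g SimpleGraph.completeGraph (Fin 4)))
    (hD : ¬ Nonempty (H ≃g diamond)) (h : IsStrongTriangle H a b c) :
    IsPendantCore H {a, b, c} := by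
  by_cases ha : ∃ x, H.Adj a x ∧ x ≠ b ∧ x ≠ c <;>
  by_cases hb : ∃ x, H.Adj b x ∧ x ≠ a ∧ x ≠ c <;>
  by_cases hc : ∃ x, H.Adj c x ∧ x ≠ a ∧ x ≠ b
  · exact ⟨a, b, c, rfl, Or.inr (Or.inr
      ((h.isPendantK4_or_iso hH ha hb hc).resolve_right h4))⟩
  · exact ⟨c, a, b, by grind, Or.inr (Or.inl ((h.rotate.rotate.isPendantDiamond_or_iso hH
      (by grind) (by grind) (by grind)).resolve_right hD))⟩
  · exact ⟨b, c, a, by grind, Or.inr (Or.inl ((h.rotate.isPendantDiamond_or_iso hH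
      (by grind) (by grind) (by grind)).resolve_right hD))⟩
  · exact ⟨b, c, a, by grind, Or.inl ((h.rotate.isPendantTriangle_or_iso hH
      (by grind) (by grind)).resolve_right h3)⟩
  · exact ⟨a, b, c, rfl, Or.inr (Or.inl ((h.isPendantDiamond_or_iso hH
      (by grind) (by grind) (by grind)).resolve_right hD))⟩
  · exact ⟨c, a, b, by grind, Or.inl ((h.rotate.rotate.isPendantTriangle_or_iso hH
      (by grind) (by grind)).resolve_right h3)⟩
  · exact ⟨a, b, c, rfl, Or.inl ((h.isPendantTriangle_or_iso hH
      (by grind) (by grind)).resolve_right h3)⟩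
  · exact ⟨a, b, c, rfl, Or.inl ((h.isPendantTriangle_or_iso hH
      (by grind) (by grind)).resolve_right h3)⟩

/-- A pendant subgraph hangs on its root, so deleting its other vertices disconnects nothing as long
as the root survives. -/
theorem pendantReduction_connected (hH : H.Connected)
    (hroot : ∀ v r, IsNonRootOf H v r → r ∉ pendantNonRoots H) :
    (pendantReduction H).Connected := by
  rw [SimpleGraph.connected_iff]
  constructor
  · intro x y
    -- A deleted vertex is counted as reached when the root it hangs on is reached; this makes `A`
    -- closed under adjacency in `H`.
    let A : Set V := {v | (∃ h : v ∈ (pendantNonRoots H)ᶜ, (pendantReduction H).Reachable x ⟨v, h⟩) ∨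
      ∃ r, IsNonRootOf H v r ∧
        ∃ h : r ∈ (pendantNonRoots H)ᶜ, (pendantReduction H).Reachable x ⟨r, h⟩}
    have hA : ∀ u ∈ A, ∀ w, H.Adj u w → w ∈ A := by
      rintro u (⟨hu, hxu⟩ | ⟨r, hur, hr, hxr⟩) w hw
      · by_cases hwN : w ∈ pendantNonRoots H
        · obtain ⟨r, hr⟩ := mem_pendantNonRoots_iff.1 hwN
          rcases hr.adj hw.symm with rfl | h
          · exact Or.inr ⟨u, hr, hu, hxu⟩
          · exact absurd (mem_pendantNonRoots_iff.2 ⟨r, h⟩) hu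
        · have hadj : (pendantReduction H).Adj ⟨u, hu⟩ ⟨w, hwN⟩ := hw
          exact Or.inl ⟨hwN, hxu.trans hadj.reachable⟩
      · rcases hur.adj hw with rfl | h
        · exact Or.inl ⟨hr, hxr⟩
        · exact Or.inr ⟨r, h, hr, hxr⟩
    rcases mem_of_connected hH.preconnected hA (u := x.1)
      (Or.inl ⟨x.2, SimpleGraph.Reachable.refl x⟩) y.1 with ⟨h, hy⟩ | ⟨r, hr, -⟩
    · exact hy
    · exact absurd (mem_pendantNonRoots_iff.2 ⟨r, hr⟩) y.2
  · obtain ⟨v⟩ := hH.nonempty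
    by_cases hv : v ∈ pendantNonRoots H
    · obtain ⟨r, hr⟩ := mem_pendantNonRoots_iff.1 hv
      exact ⟨⟨r, hroot v r hr⟩⟩
    · exact ⟨⟨v, hv⟩⟩

variable (H) in
/-- The graph `F - (N_F(u) ∩ R_△(H))`, where `F` is the pendant reduction of `H`. -/
abbrev strippedReduction (u : ↥((pendantNonRoots H)ᶜ)) :
    SimpleGraph ↥((pendantReduction H).neighborSet u ∩ Subtype.val ⁻¹' triangleRoots H)ᶜ :=
  deleteVerts (pendantReduction H)
    ((pendantReduction H).neighborSet u ∩ Subtype.val ⁻¹' triangleRoots H)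

/-- A matching of the stripped graph that misses `u` and covers all its neighbours extends to such a
matching of `H`: each deleted triangle root is matched into one of its pendant triangles, and each
pendant diamond rooted at `u` contributes its middle edge. Its tip is not adjacent to `u`. -/
theorem IsUnavoidable.strippedReduction {u : ↥((pendantNonRoots H)ᶜ)}
    (hu : IsUnavoidable H (u : V)) (hk : (u : V) ∉ k4Roots H) (ht : (u : V) ∉ triangleRoots H) :
    IsUnavoidable (strippedReduction H u) ⟨u, mem_compl_neighborSet_inter _ u _⟩ := by
  intro N hN hp hv
  by_contra! hcon
  have hex : ∀ c ∈ triangleRoots H, ∃ a, ∃ b, IsPendantTriangle H a b c := fun c hc => hc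
  -- A root may carry several pendant triangles, but only one of them may be used to cover it.
  choose! τ hτ using hex
  -- `D` holds the oriented edges from triangle roots into their chosen triangles, `B` the middle
  -- edges of diamonds at `u`, `E` the given matching. Membership in `pendantNonRoots` and the
  -- degrees 2 and 3 keep the three kinds disjoint.
  let D : V → V → Prop := fun x y => H.Adj u x ∧ x ∈ triangleRoots H ∧ y = τ x
  let B : V → V → Prop := fun x y => ∃ a, IsPendantDiamond H a x y u
  let E : V → V → Prop := fun x y => ∃ p q, N.Adj p q ∧ p.1.1 = x ∧ q.1.1 = y
  have hDN : ∀ x y, D x y → x ∉ pendantNonRoots H := fun x y h =>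
    notMem_pendantNonRoots_of_mem_triangleRoots h.2.1
  have hDN' : ∀ x y, D y x → x ∈ pendantNonRoots H ∧ H.degree x = 2 := by
    rintro x y ⟨-, hy, rfl⟩
    obtain ⟨b, hb⟩ := hτ y hy
    exact ⟨Or.inl ⟨_, _, _, hb, Or.inl rfl⟩, hb.deg_a⟩
  have hBN : ∀ x y, B x y → x ∈ pendantNonRoots H ∧ H.degree x = 3 := by
    rintro x y ⟨a, ha⟩
    exact ⟨Or.inr (Or.inl ⟨_, _, _, _, ha, Or.inr (Or.inl rfl)⟩), ha.deg_b⟩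
  have hEN : ∀ x y, E x y → x ∉ pendantNonRoots H := by
    rintro _ y ⟨p, q, -, rfl, -⟩
    exact p.1.2
  have hED : ∀ x y z, E x y → ¬ D x z := by
    rintro _ y z ⟨p, q, -, rfl, -⟩ ⟨h₁, h₂, -⟩
    exact p.2 ⟨h₁, h₂⟩
  have hle : ∀ x y, E x y ∨ D x y ∨ D y x ∨ B x y → H.Adj x y := by
    rintro x y (⟨p, q, hpq, rfl, rfl⟩ | ⟨-, hx, rfl⟩ | ⟨-, hy, rfl⟩ | ⟨a, ha⟩)
    · exact hN hpq
    · obtain ⟨b, hb⟩ := hτ x hx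
      exact hb.ac.symm
    · obtain ⟨b, hb⟩ := hτ y hy
      exact hb.ac
    · exact ha.bc
  let M : SimpleGraph V :=
    { Adj := fun x y => E x y ∨ D x y ∨ D y x ∨ B x y
      symm := ⟨by
        rintro x y (⟨p, q, hpq, hp, hq⟩ | h | h | ⟨a, ha⟩)
        · exact Or.inl ⟨q, p, hpq.symm, hq, hp⟩
        · exact Or.inr (Or.inr (Or.inl h))
        · exact Or.inr (Or.inl h)
        · exact Or.inr (Or.inr (Or.inr ⟨a, ha.swap⟩))⟩
      loopless := ⟨fun x h => (hle x x h).ne rfl⟩ }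
  have hM : IsPairing M := by
    intro x y z hy hz
    rcases hy with hy | hy | hy | hy <;> rcases hz with hz | hz | hz | hz
    · obtain ⟨p, q, hpq, hpx, rfl⟩ := hy
      obtain ⟨p', q', hpq', hpx', rfl⟩ := hz
      obtain rfl : p = p' := Subtype.ext (Subtype.ext (hpx.trans hpx'.symm))
      rw [hp hpq hpq']
    · exact absurd hz (hED _ _ _ hy)
    · exact absurd (hDN' _ _ hz).1 (hEN _ _ hy)
    · exact absurd (hBN _ _ hz).1 (hEN _ _ hy)
    · exact absurd hy (hED _ _ _ hz)
    · exact hy.2.2.trans hz.2.2.symm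
    · exact absurd (hDN' _ _ hz).1 (hDN _ _ hy)
    · exact absurd (hBN _ _ hz).1 (hDN _ _ hy)
    · exact absurd (hDN' _ _ hy).1 (hEN _ _ hz)
    · exact absurd (hDN' _ _ hy).1 (hDN _ _ hz)
    · obtain ⟨-, hy, rfl⟩ := hy
      obtain ⟨-, hz, heq⟩ := hz
      obtain ⟨b, hb⟩ := hτ y hy
      obtain ⟨b', hb'⟩ := hτ z hz
      rw [← heq] at hb'
      rcases hb.adj_a hb'.ac with rfl | rfl
      · have := hb.deg_b
        have := hb'.deg_c
        omega
      · rfl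
    · have := (hDN' _ _ hy).2
      have := (hBN _ _ hz).2
      omega
    · exact absurd (hBN _ _ hy).1 (hEN _ _ hz)
    · exact absurd (hBN _ _ hy).1 (hDN _ _ hz)
    · have := (hDN' _ _ hz).2
      have := (hBN _ _ hy).2
      omega
    · obtain ⟨a, ha⟩ := hy
      obtain ⟨a', ha'⟩ := hz
      rcases ha.adj_b ha'.bc with rfl | rfl | rfl
      · have := ha.deg_a
        have := ha'.deg_c
        omega
      · rfl
      · exact absurd ha'.cd (H.irrefl)
  have hMu : ∀ x, ¬ M.Adj u x := by
    rintro x (⟨p, q, hpq, hpu, -⟩ | h | h | h)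
    · obtain rfl : p = ⟨u, mem_compl_neighborSet_inter _ u _⟩ := Subtype.ext (Subtype.ext hpu)
      exact hv q hpq
    · exact ht h.2.1
    · exact u.2 (hDN' _ _ h).1
    · exact u.2 (hBN _ _ h).1
  obtain ⟨w, huw, hw⟩ := hu M (fun x y h => hle x y h) hM hMu
  by_cases hwN : w ∈ pendantNonRoots H
  · obtain ⟨r, hr⟩ := mem_pendantNonRoots_iff.1 hwN
    -- As `u` is not itself a non-root vertex, the pendant subgraph containing `w` has root `u`.
    rcases hr.adj huw.symm with rfl | h
    · rcases hr with ⟨a, b, h, -⟩ | ⟨a, b, c, h, rfl | rfl | rfl⟩ | ⟨a, b, c, h, -⟩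
      · exact ht ⟨a, b, h⟩
      · exact h.not_ad huw.symm
      · exact hw c (Or.inr (Or.inr (Or.inr ⟨a, h⟩)))
      · exact hw b (Or.inr (Or.inr (Or.inr ⟨a, h.swap⟩)))
      · exact hk ⟨a, b, c, h⟩
    · exact u.2 (mem_pendantNonRoots_iff.2 ⟨r, h⟩)
  · by_cases hwR : w ∈ triangleRoots H
    · exact hw (τ w) (Or.inr (Or.inl ⟨huw, hwR, rfl⟩))
    · obtain ⟨x, hx⟩ := hcon ⟨⟨w, hwN⟩, fun h => hwR h.2⟩ huw
      exact hw x.1.1 (Or.inl ⟨_, x, hx, rfl, rfl⟩)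

/-- Restrict a matching of `H` missing `u` to the stripped graph and take a free neighbour `w`. A
lost edge `wx` would make `w` the root of a pendant subgraph containing `x`, or `x` a triangle root.
The hypotheses exclude both; in a bipartition they hold because `w` lies in `W` and `x` in `U`. -/
theorem IsUnavoidable.of_strippedReduction {u : ↥((pendantNonRoots H)ᶜ)}
    (hu : IsUnavoidable (LocalizableGraph.strippedReduction H u)
      ⟨u, mem_compl_neighborSet_inter _ u _⟩)
    (h₁ : ∀ w, (pendantReduction H).Adj u w → (w : V) ∉ diamondRoots H ∪ k4Roots H)
    (h₂ : ∀ w x, (pendantReduction H).Adj u w → (pendantReduction H).Adj w x →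
      (x : V) ∉ triangleRoots H) :
    IsUnavoidable H (u : V) := by
  intro N hN hp hv
  obtain ⟨w, huw, hw⟩ := hu (N.comap fun p => p.1.1) (fun p q h => hN h)
    (fun p q r hq hr => Subtype.ext (Subtype.ext (hp hq hr))) (fun q => hv _)
  refine ⟨w.1.1, huw, fun x hx => ?_⟩
  by_cases hxN : x ∈ pendantNonRoots H
  · obtain ⟨r, hr⟩ := mem_pendantNonRoots_iff.1 hxN
    rcases hr.adj (hN hx).symm with rfl | h
    · rcases hr.root_mem with h | h
      · exact w.2 ⟨huw, h⟩
      · exact h₁ w.1 huw h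
    · exact w.1.2 (mem_pendantNonRoots_iff.2 ⟨r, h⟩)
  · exact hw ⟨⟨x, hxN⟩, fun h => h₂ w.1 ⟨x, hxN⟩ huw (hN hx) h.2⟩ hx

theorem isUnavoidable_of_mem_k4Roots {d : V} (hd : d ∈ k4Roots H) : IsUnavoidable H d := by
  obtain ⟨a, b, c, h⟩ := hd
  exact isUnavoidable_of_k4 h.ad.symm h.bd.symm h.cd.symm h.ab.ne h.ac.ne h.bc.ne
    (fun _ => h.adj_a) (fun _ => h.rotate.adj_a) (fun _ => h.rotate.rotate.adj_a)

end LocalizableGraph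

/-! ### The two directions of the characterization -/

namespace LocalizableGraph

variable {V : Type*} [Fintype V] {H : SimpleGraph V} [DecidableRel H.Adj]

/-- The stars in a partition of the edges into strong cliques determine one side of a bipartition
of the pendant reduction. -/
theorem exists_center_set (hH : H.Connected)
    (h3 : ¬ Nonempty (H ≃g SimpleGraph.completeGraph (Fin 3)))
    (h4 : ¬ Nonempty (H ≃g SimpleGraph.completeGraph (Fin 4)))
    (hD : ¬ Nonempty (H ≃g diamond)) (hloc : IsLocalizable H.lineGraph) :
    ∃ S : Set V, (∀ v ∈ S, IsUnavoidable H v) ∧ (∀ u ∈ S, ∀ v ∈ S, ¬ H.Adj u v) ∧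
      (∀ x y, x ∉ pendantNonRoots H → y ∉ pendantNonRoots H → H.Adj x y → x ∈ S ∨ y ∈ S) ∧
      diamondRoots H ∪ k4Roots H ⊆ S ∧ ∀ r ∈ triangleRoots H, r ∉ S := by
  obtain ⟨S, T, hS, hSS, hST, -, hcover⟩ := hloc.exists_cover
  refine ⟨S, hS, hSS, ?_, ?_, ?_⟩
  · intro x y hx hy hxy
    rcases hcover x y hxy with h | h | ⟨z, h, -⟩
    · exact Or.inl h
    · exact Or.inr h
    · rcases (h.isPendantCore hH h3 h4 hD).mem_pendantNonRoots_or (by simp) (by simp) hxy.ne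
        with h | h
      · exact absurd h hx
      · exact absurd h hy
  · rintro d (⟨a, b, c, h⟩ | ⟨a, b, c, h⟩)
    · rcases hcover b d h.bd with hb | hd | ⟨z, hz, -⟩
      · exact absurd (hS b hb) h.not_isUnavoidable_b
      · exact hd
      · exfalso
        -- The edge `bd` lies in no strong triangle: the third vertex would be `c`, yet `ba` and
        -- `dx` leave `bdc` with different ends. The `K₄` case is analogous.
        obtain ⟨x, hx, hxb, hxc⟩ := h.exists_adj_d
        rcases h.adj_b hz.ac with rfl | rfl | rfl
        · exact h.not_ad hz.bc.symm
        · obtain rfl := hz.out_ab a x h.ne_ad h.ac.ne hxb hxc h.ab.symm hx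
          exact h.not_ad hx.symm
        · exact hz.bc.ne rfl
    · rcases hcover a d h.ad with ha | hd | ⟨z, hz, -⟩
      · exact absurd (hS a ha) h.not_isUnavoidable
      · exact hd
      · exfalso
        obtain ⟨x, hx, hxa, hxb, hxc⟩ := h.exists_adj_d
        rcases h.adj_a hz.ac with rfl | rfl | rfl
        · exact hxc (hz.out_ab c x h.cd.ne h.bc.ne' hxa hxb h.ac hx).symm
        · exact hxb (hz.out_ab b x h.bd.ne h.bc.ne hxa hxc h.ab hx).symm
        · exact hz.bc.ne rfl
  · rintro r ⟨a, b, h⟩ hr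
    -- Neither `a` nor `b` is strong, so `ab` is covered by the triangle `abr`, whose vertices avoid
    -- `S`.
    rcases hcover a b h.ab with ha | hb | ⟨z, hz, hzT⟩
    · exact h.not_isUnavoidable (hS a ha)
    · exact h.swap.not_isUnavoidable (hS b hb)
    · rcases h.adj_a hz.ac with rfl | rfl
      · exact hz.bc.ne rfl
      · exact hST _ hr _ hzT (by simp)

theorem isLocalizable_of_bipartition {U W : Set ↥((pendantNonRoots H)ᶜ)} (hUW : IsCompl U W)
    (hU : (pendantReduction H).IsIndepSet U) (hW : (pendantReduction H).IsIndepSet W)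
    (hUroots : diamondRoots H ∪ k4Roots H ⊆ Subtype.val '' U)
    (hWroots : triangleRoots H ⊆ Subtype.val '' W)
    (hstrong : ∀ u ∈ U, (u : V) ∉ k4Roots H →
      IsUnavoidable (strippedReduction H u) ⟨u, mem_compl_neighborSet_inter _ u _⟩) :
    IsLocalizable H.lineGraph := by
  have hdisj : ∀ u ∈ U, u ∉ W := fun u hu hw => Set.disjoint_left.1 hUW.disjoint hu hw
  have hmem : ∀ u, u ∉ U → u ∈ W := fun u hu => by
    rw [← hUW.compl_eq]
    exact hu
  have hUt : ∀ u ∈ U, (u : V) ∉ triangleRoots H := by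
    intro u hu ht
    obtain ⟨w, hw, hwu⟩ := hWroots ht
    obtain rfl := Subtype.ext hwu
    exact hdisj w hu hw
  have hWr : ∀ w ∈ W, (w : V) ∉ diamondRoots H ∪ k4Roots H := by
    intro w hw hr
    obtain ⟨u, hu, huw⟩ := hUroots hr
    obtain rfl := Subtype.ext huw
    exact hdisj u hu hw
  have hUadj : ∀ u ∈ U, ∀ w, (pendantReduction H).Adj u w → w ∈ W := fun u hu w huw =>
    hmem w fun hw => hU hu hw huw.ne huw
  have hWadj : ∀ w ∈ W, ∀ u, (pendantReduction H).Adj w u → u ∈ U := fun w hw u hwu => by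
    by_contra hu
    exact hW hw (hmem u hu) hwu.ne hwu
  have hcore : ∀ u ∈ U, ∀ s, IsPendantCore H s → (u : V) ∉ s := by
    intro u hu s hs hus
    rcases hs.mem_pendantNonRoots_or_mem_triangleRoots hus with h | h
    · exact u.2 h
    · exact hUt u hu h
  -- One of two shared vertices is a non-root vertex. A vertex of `t` outside `s` would be its
  -- neighbour, hence a diamond or `K₄` root and so in `U`, which no core meets.
  have hsub : ∀ s, IsPendantCore H s → ∀ t, IsPendantCore H t → ∀ x y, x ≠ y → x ∈ s →
      y ∈ s → x ∈ t → y ∈ t → t ⊆ s := by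
    intro s hs t ht x y hxy hxs hys hxt hyt z hz
    by_contra hzs
    have key : ∀ x ∈ s, x ∈ t → x ∈ pendantNonRoots H → False := by
      intro x hxs hxt hx
      have hxz : x ≠ z := fun h => hzs (h ▸ hxs)
      rcases hs.adj hxs hx (ht.isClique hxt hz hxz) with h | h
      · exact hzs h
      · obtain ⟨u, hu, rfl⟩ := hUroots h
        exact hcore u hu t ht hz
    rcases hs.mem_pendantNonRoots_or hxs hys hxy with h | h
    · exact key x hxs hxt h
    · exact key y hys hyt h
  refine isLocalizable_of_cover H (Subtype.val '' U) {s | IsPendantCore H s} ?_ ?_ ?_ ?_ ?_ ?_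
  · rintro _ ⟨u, hu, rfl⟩
    by_cases hk : (u : V) ∈ k4Roots H
    · exact isUnavoidable_of_mem_k4Roots hk
    · exact (hstrong u hu hk).of_strippedReduction (fun w huw => hWr w (hUadj u hu w huw))
        fun w x huw hwx => hUt x (hWadj w (hUadj u hu w huw) x hwx)
  · rintro _ ⟨u, hu, rfl⟩ _ ⟨v, hv, rfl⟩ huv
    exact hU hu hv (fun h => huv.ne (congrArg Subtype.val h)) huv
  · exact fun s hs => IsPendantCore.exists_isStrongTriangle hs
  · rintro _ ⟨u, hu, rfl⟩ s hs
    exact hcore u hu s hs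
  · intro s hs t ht x y hxy hxs hys hxt hyt
    exact (hsub t ht s hs x y hxy hxt hyt hxs hys).antisymm
      (hsub s hs t ht x y hxy hxs hys hxt hyt)
  · have key : ∀ x y, H.Adj x y → x ∈ pendantNonRoots H →
        y ∈ Subtype.val '' U ∨ ∃ s ∈ {s | IsPendantCore H s}, x ∈ s ∧ y ∈ s := by
      intro x y hxy hx
      obtain ⟨s, hs, hxs⟩ := exists_isPendantCore hx
      rcases hs.adj hxs hx hxy with h | h
      · exact Or.inr ⟨s, hs, hxs, h⟩
      · exact Or.inl (hUroots h)
    intro x y hxy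
    by_cases hx : x ∈ pendantNonRoots H
    · exact Or.inr (key x y hxy hx)
    by_cases hy : y ∈ pendantNonRoots H
    · rcases key y x hxy.symm hy with h | ⟨s, hs, hys, hxs⟩
      · exact Or.inl h
      · exact Or.inr (Or.inr ⟨s, hs, hxs, hys⟩)
    by_cases hxU : (⟨x, hx⟩ : ↥((pendantNonRoots H)ᶜ)) ∈ U
    · exact Or.inl ⟨_, hxU, rfl⟩
    · exact Or.inr (Or.inl ⟨_, hWadj _ (hmem _ hxU) ⟨y, hy⟩ hxy, rfl⟩)

end LocalizableGraph

theorem mainTheorem2 {V : Type*} [Fintype V] (H : SimpleGraph V) [DecidableRel H.Adj]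
    (hH : H.Connected) :
    LocalizableGraph.IsLocalizable H.lineGraph ↔
      ((¬ Nonempty (H ≃g SimpleGraph.completeGraph (Fin 3)) ∧
        ¬ Nonempty (H ≃g SimpleGraph.completeGraph (Fin 4)) ∧
        ¬ Nonempty (H ≃g LocalizableGraph.diamond) ∧
        (LocalizableGraph.pendantReduction H).Connected ∧
        ∃ U W : Set ↥((LocalizableGraph.pendantNonRoots H)ᶜ),
          IsCompl U W ∧
          (LocalizableGraph.pendantReduction H).IsIndepSet U ∧
          (LocalizableGraph.pendantReduction H).IsIndepSet W ∧
          LocalizableGraph.diamondRoots H ∪ LocalizableGraph.k4Roots H ⊆ Subtype.val '' U ∧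
          LocalizableGraph.triangleRoots H ⊆ Subtype.val '' W ∧
          ∀ u ∈ U, (u : V) ∉ LocalizableGraph.k4Roots H →
            LocalizableGraph.IsStrongVertex
              (LocalizableGraph.deleteVerts (LocalizableGraph.pendantReduction H)
                ((LocalizableGraph.pendantReduction H).neighborSet u ∩
                  Subtype.val ⁻¹' LocalizableGraph.triangleRoots H))
              ⟨u, LocalizableGraph.mem_compl_neighborSet_inter _ u _⟩) ∨
      (Nonempty (H ≃g SimpleGraph.completeGraph (Fin 3)) ∨
        Nonempty (H ≃g SimpleGraph.completeGraph (Fin 4)))) := by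
  constructor
  · intro hloc
    by_cases h3 : Nonempty (H ≃g SimpleGraph.completeGraph (Fin 3))
    · exact Or.inr (Or.inl h3)
    by_cases h4 : Nonempty (H ≃g SimpleGraph.completeGraph (Fin 4))
    · exact Or.inr (Or.inr h4)
    have hD : ¬ Nonempty (H ≃g LocalizableGraph.diamond) := fun h =>
      LocalizableGraph.not_isLocalizable_of_iso_diamond h hloc
    obtain ⟨S, h₁, h₂, h₃, h₄, h₅⟩ :=
      LocalizableGraph.exists_center_set hH h3 h4 hD hloc
    refine Or.inl ⟨h3, h4, hD, LocalizableGraph.pendantReduction_connected hH ?_,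
      {u | u.1 ∈ S}, {u | u.1 ∈ S}ᶜ, isCompl_compl, ?_, ?_, ?_, ?_, ?_⟩
    -- Roots survive the deletion: triangle roots by their degrees, the others because they lie in
    -- `S` and are strong, which no non-root vertex is.
    · intro v r hr
      rcases hr.root_mem with h | h
      · exact LocalizableGraph.notMem_pendantNonRoots_of_mem_triangleRoots h
      · exact fun hmem => LocalizableGraph.not_isUnavoidable_of_mem_pendantNonRoots hmem
          (h₁ r (h₄ h))
    · intro u hu v hv _ hadj
      exact h₂ u hu v hv hadj
    · intro u hu v hv _ hadj
      rcases h₃ u v u.2 v.2 hadj with h | h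
      · exact hu h
      · exact hv h
    · intro r hr
      exact ⟨⟨r, fun hmem => LocalizableGraph.not_isUnavoidable_of_mem_pendantNonRoots hmem
        (h₁ r (h₄ hr))⟩, h₄ hr, rfl⟩
    · intro r hr
      exact ⟨⟨r, LocalizableGraph.notMem_pendantNonRoots_of_mem_triangleRoots hr⟩, h₅ r hr, rfl⟩
    · intro u hu hk
      rw [LocalizableGraph.isStrongVertex_iff]
      exact (h₁ u hu).strippedReduction hk fun ht => h₅ u ht hu
  · rintro (⟨-, -, -, -, U, W, hUW, hU, hW, hUroots, hWroots, hstrong⟩ | h | h)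
    · exact LocalizableGraph.isLocalizable_of_bipartition hUW hU hW hUroots hWroots
        fun u hu hk => (LocalizableGraph.isStrongVertex_iff _ _).1 (hstrong u hu hk)
    · exact LocalizableGraph.isLocalizable_of_iso_completeGraph_three h
    · exact LocalizableGraph.isLocalizable_of_iso_completeGraph_four h
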